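/- Let $\mathbb F$ be a subfield of $\mathbb C$ such that $\bar x\in\mathbb F$ for all $x\in\mathbb F$ and $\sqrt y\in\mathbb F$ for all $y\in\mathbb F$ with $y>0$. Let $1\le r\le s$ and let $P$ be an $r\times s$ matrix of Laurent polynomials with coefficients in $\mathbb F$. Notation. For $P(z)=\sum_k P_kz^k$ put $P^*(z)=\sum_k \overline{P_k}^{T}z^{-k}$. A Laurent polynomial $p=\sum_k p_kz^k$ has symmetry pattern $\mathcal Sp=\varepsilon z^c$ ($\varepsilon\in\{-1,1\}$, $c\in\mathbb Z$) if $p_{c-k}=\varepsilon p_k$ for all $k$; the zero polynomial has every symmetry pattern. For a matrix $P$ of Laurent polynomials with symmetry, a pattern matrix $\mathcal SP$ is obtained entrywise, with some choice at the zero entries. A pattern vector is a row vector $\sigma=[\varepsilon_1z^{c_1},\dots,\varepsilon_nz^{c_n}]$ (equivalently $\sigma=\mathcal S\theta$ for a row vector $\theta$ of Laurent polynomials with symmetry). $P$ has compatible symmetry if $\mathcal SP=\sigma_1^*\sigma_2$ for some pattern vectors $\sigma_1,\sigma_2$ and some choice of $\mathcal SP$. Pattern matrices $\mathcal SP,\mathcal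 SQ$ are mutually compatible if $\mathcal SP=\sigma_1^*\sigma$ and $\mathcal SQ=\sigma^*\sigma_2$ for some pattern vectors $\sigma_1,\sigma,\sigma_2$. For $p\ne0$ let $|\mathrm{cs}(p)|=n-m$, where $m$ and $n$ are the least and the greatest $k$ with $p_k\neq0$; $|\mathrm{cs}(0)|=-\infty$. For $\sigma=[\varepsilon_1z^{c_1},\dots,\varepsilon_nz^{c_n}]$, let $U_\sigma$ denote any matrix $\mathrm{diag}(z^{-\lceil c_1/2\rceil},\dots,z^{-\lceil c_n/2\rceil})E$, where $E$ is a permutation matrix that groups the patterns $\varepsilon_iz^{c_i-2\lceil c_i/2\rceil}\in\{\pm1,\pm z^{-1}\}$ in the order $1,\dots,1,-1,\dots,-1,z^{-1},\dots,z^{-1},-z^{-1},\dots,-z^{-1}$. Theorem. $PP^*=I_r$ and $P$ has compatible symmetry if and only if, for some pattern vectors $\sigma_1$ (of size $r$) and $\sigma_2$ (of size $s$) and some choice of $U_{\sigma_1},U_{\sigma_2}$, there exist $J\ge0$ and $s\times s$ matrices $P_0,\dots,P_{J+1}$ of Laurent polynomials with coefficients in $\mathbb F$ such that 1. $P_e:=P_{J+1}P_J\cdots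 P_1P_0$ is paraunitary: $P_eP_e^*=I_s$; 2. $P=[I_r,\mathbf 0]\,P_{J+1}P_J\cdots P_1P_0$; 3. $P_j$, $1\le j\le J$, is elementary: $P_jP_j^*=I_s$ and the coefficients of $z^k$ in $P_j$ vanish for $k\notin[-1,1]$; 4. for each $0\le j\le J+1$ one can choose a pattern matrix $\mathcal SP_j$ of $P_j$ so that $\mathcal SP_{j+1},\mathcal SP_j$ are mutually compatible for all $0\le j\le J$; 5. $P_0=U_{\sigma_2}^*$ and $P_{J+1}=\mathrm{diag}(U_{\sigma_1},I_{s-r})$; 6. $J\le\max\bigl\{1,\ \max_{1\le m\le r,\,1\le n\le s}\lceil|\mathrm{cs}([P]_{m,n})|/2\rceil\bigr\}$. Moreover, if $PP^*=I_r$ and $\mathcal SP=\sigma_1^*\sigma_2$ for some choice of $\mathcal SP$, then such $J,P_0,\dots,P_{J+1}$ exist for these $\sigma_1,\sigma_2$ and every choice of $U_{\sigma_1},U_{\sigma_2}$. -/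

import Mathlib

open scoped LaurentPolynomial

noncomputable section

namespace SymExt

/-- Matrices of Laurent polynomials with complex coefficients. -/
abbrev LMat (r s : ℕ) := Matrix (Fin r) (Fin s) ℂ[T;T⁻¹]

/-- A subfield of `ℂ` closed under complex conjugation and under (positive) square roots of its
positive elements. -/
def IsAdmissibleField (K : Subfield ℂ) : Prop :=
  (∀ x ∈ K, (starRingEnd ℂ) x ∈ K) ∧
  (∀ y : ℝ, 0 < y → (y : ℂ) ∈ K → ((Real.sqrt y : ℝ) : ℂ) ∈ K)

/-- All coefficients of all entries of `P` lie in `K`. -/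
def HasCoeffsIn (K : Subfield ℂ) {r s : ℕ} (P : LMat r s) : Prop :=
  ∀ i j k, (P i j).coeff k ∈ K

/-- `p*(z) = ∑ conj(p_k) z^{-k}` for `p(z) = ∑ p_k z^k`. -/
def pstar (p : ℂ[T;T⁻¹]) : ℂ[T;T⁻¹] :=
  LaurentPolynomial.invert (AddMonoidAlgebra.mapRingHom ℤ (starRingEnd ℂ) p)

/-- `P*(z) = ∑ P_k* z^{-k}` for `P(z) = ∑ P_k z^k`, where `P_k*` is the conjugate transpose. -/
def mstar {r s : ℕ} (P : LMat r s) : LMat s r :=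
  fun j i => pstar (P i j)

/-- `P(z) P*(z) = I_r`; for square matrices this says that `P` is paraunitary. -/
def IsParaunitary {r s : ℕ} (P : LMat r s) : Prop :=
  P * mstar P = 1

/-! ### Symmetry -/

/-- A symmetry pattern `ε z^c` with `ε ∈ {-1, 1}` and `c ∈ ℤ`. -/
structure SymType where
  sign : ℤˣ
  exp : ℤ

/-- `𝒮p = ε z^c`, that is, `p_{c-k} = ε p_k` for all `k`. The zero polynomial has every symmetry
pattern; a nonzero polynomial has at most one. -/
def HasSym (p : ℂ[T;T⁻¹]) (σ : SymType) : Prop :=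
  ∀ k : ℤ, p.coeff (σ.exp - k) = ((σ.sign : ℤ) : ℂ) * p.coeff k

/-- `S` is a symmetry pattern `𝒮P` of the matrix `P` (with some choice at the zero entries). -/
def HasSymMatrix {r s : ℕ} (P : LMat r s) (S : Matrix (Fin r) (Fin s) SymType) : Prop :=
  ∀ i j, HasSym (P i j) (S i j)

/-- The pattern matrix `(𝒮θ₁)* 𝒮θ₂`, for row vectors `σ₁ = 𝒮θ₁` and `σ₂ = 𝒮θ₂` of patterns: its
`(i,j)` entry is `(ε_i z^{c_i})* (ε'_j z^{c'_j}) = ε_i ε'_j z^{c'_j - c_i}`. Every vector of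
patterns is `𝒮θ` for some row vector `θ` of nonzero Laurent polynomials with symmetry, see
`exists_ne_zero_hasSym`, so below we quantify over the pattern vectors themselves. -/
def starMul {r s : ℕ} (σ₁ : Fin r → SymType) (σ₂ : Fin s → SymType) :
    Matrix (Fin r) (Fin s) SymType :=
  fun i j => ⟨(σ₁ i).sign * (σ₂ j).sign, (σ₂ j).exp - (σ₁ i).exp⟩

/-- `P` has compatible symmetry: `𝒮P = (𝒮θ₁)* 𝒮θ₂` for some `θ₁`, `θ₂`. -/
def HasCompatibleSym {r s : ℕ} (P : LMat r s) : Prop :=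
  ∃ (σ₁ : Fin r → SymType) (σ₂ : Fin s → SymType), HasSymMatrix P (starMul σ₁ σ₂)

/-- Mutual compatibility of the symmetry patterns `S = 𝒮P` and `S' = 𝒮Q`:
`𝒮P = (𝒮θ₁)* 𝒮θ` and `𝒮Q = (𝒮θ)* 𝒮θ₂` for some `θ₁`, `θ`, `θ₂`. -/
def MutuallyCompatible {r s t : ℕ} (S : Matrix (Fin r) (Fin s) SymType)
    (S' : Matrix (Fin s) (Fin t) SymType) : Prop :=
  ∃ (σ₁ : Fin r → SymType) (σ : Fin s → SymType) (σ₂ : Fin t → SymType),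
    S = starMul σ₁ σ ∧ S' = starMul σ σ₂

theorem exists_ne_zero_hasSym (σ : SymType) : ∃ p : ℂ[T;T⁻¹], p ≠ 0 ∧ HasSym p σ := by
  obtain ⟨n, hn⟩ : ∃ n : ℤ, σ.exp - n ≠ n := ⟨σ.exp + 1 + |σ.exp|, by
    have := neg_abs_le σ.exp; have := abs_nonneg σ.exp; omega⟩
  have hs : ((σ.sign : ℤ) : ℂ) * ((σ.sign : ℤ) : ℂ) = 1 := by
    rcases Int.units_eq_one_or σ.sign with h | h <;> simp [h]
  have hc : ∀ k : ℤ, (AddMonoidAlgebra.single n (1 : ℂ)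
      + AddMonoidAlgebra.single (σ.exp - n) ((σ.sign : ℤ) : ℂ) : ℂ[T;T⁻¹]).coeff k =
      (if n = k then 1 else 0) + (if σ.exp - n = k then ((σ.sign : ℤ) : ℂ) else 0) := by
    intro k
    rw [AddMonoidAlgebra.coeff_add, Finsupp.add_apply, AddMonoidAlgebra.coeff_single,
      AddMonoidAlgebra.coeff_single, Finsupp.single_apply, Finsupp.single_apply]
  refine ⟨AddMonoidAlgebra.single n (1 : ℂ)
      + AddMonoidAlgebra.single (σ.exp - n) ((σ.sign : ℤ) : ℂ), fun h => ?_, fun k => ?_⟩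
  · have h2 := hc n
    rw [h, if_pos rfl, if_neg hn] at h2
    simp at h2
  · have e1 : (n = σ.exp - k) ↔ (σ.exp - n = k) := by omega
    have e2 : (σ.exp - n = σ.exp - k) ↔ (n = k) := by omega
    rw [hc, hc]
    simp only [e1, e2, mul_add, mul_ite, mul_one, mul_zero, hs]
    rw [add_comm]

/-! ### Coefficient support -/

/-- The length `n - m` of the coefficient support `[m, n]` of `p`, which is `-∞` for `p = 0`. -/
def csLength (p : ℂ[T;T⁻¹]) : WithBot ℕ :=
  open scoped Classical in
  if h : p.coeff.support.Nonempty then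
    (((p.coeff.support.max' h - p.coeff.support.min' h).toNat : ℕ) : WithBot ℕ)
  else ⊥

/-- `max_{m,n} ⌈|cs([P]_{m,n})| / 2⌉`. -/
def maxHalfLength {r s : ℕ} (P : LMat r s) : WithBot ℕ :=
  Finset.univ.sup fun mn : Fin r × Fin s =>
    (csLength (P mn.1 mn.2)).map fun l : ℕ => ⌈(l : ℚ) / 2⌉₊

/-- `cs(P) ⊆ [-1, 1]`. -/
def SupportedInUnit {r s : ℕ} (P : LMat r s) : Prop :=
  ∀ i j k, (P i j).coeff k ≠ 0 → -1 ≤ k ∧ k ≤ 1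

/-- Elementary matrices: paraunitary with coefficient support contained in `[-1, 1]`. -/
def IsElementary {s : ℕ} (P : LMat s s) : Prop :=
  IsParaunitary P ∧ SupportedInUnit P

/-! ### The monomial matrices `U_{𝒮θ}` -/

/-- The pattern `ε z^{c - 2⌈c/2⌉} ∈ {±1, ±z⁻¹}` of `θ_i z^{-⌈c/2⌉}` when `𝒮θ_i = ε z^c`. -/
def SymType.normalize (σ : SymType) : SymType :=
  ⟨σ.sign, σ.exp - 2 * ⌈(σ.exp : ℚ) / 2⌉⟩

/-- The position of a normalized pattern in the list `1, -1, z⁻¹, -z⁻¹`. -/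
def SymType.rank (σ : SymType) : ℕ :=
  (if σ.exp = 0 then 0 else 2) + (if σ.sign = 1 then 0 else 1)

/-- `U` is a matrix `U_{𝒮θ} = diag(z^{-⌈c_1/2⌉}, …, z^{-⌈c_n/2⌉}) E_θ`, where
`𝒮θ = σ = [ε_1 z^{c_1}, …, ε_n z^{c_n}]` and `E_θ` is a permutation matrix such that
`𝒮(θ U) = [1_{n_1}, -1_{n_2}, z⁻¹ 1_{n_3}, -z⁻¹ 1_{n_4}]`. The `k`-th entry of `θ U` is
`θ_i z^{-⌈c_i/2⌉}` with `i = e.symm k`, so the latter says that the positions of the normalized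
patterns in the list `1, -1, z⁻¹, -z⁻¹` are monotone in `k`. -/
def IsReorganizer {n : ℕ} (σ : Fin n → SymType) (U : LMat n n) : Prop :=
  ∃ e : Equiv.Perm (Fin n),
    U = Matrix.diagonal (fun i => LaurentPolynomial.T (-⌈((σ i).exp : ℚ) / 2⌉))
          * e.permMatrix ℂ[T;T⁻¹] ∧
    Monotone fun k => (σ (e.symm k)).normalize.rank

/-! ### The factorization -/

/-- The `r × s` matrix `[I_r, 0]`. -/
def firstRows (r s : ℕ) : LMat r s :=
  fun i j => if (i : ℕ) = j then 1 else 0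

/-- The `s × s` matrix `diag(U, I_{s-r})` (for `r ≤ s`). -/
def extendById {r : ℕ} (s : ℕ) (U : LMat r r) : LMat s s :=
  fun i j =>
    if h : (i : ℕ) < r ∧ (j : ℕ) < r then U ⟨i, h.1⟩ ⟨j, h.2⟩
    else if i = j then 1 else 0

/-- The product `P_{J+1} P_J ⋯ P_1 P_0`. -/
def descProd {s J : ℕ} (F : Fin (J + 2) → LMat s s) : LMat s s :=
  (List.ofFn fun j => F j.rev).prod

/-- `P = [I_r, 0] P_{J+1} ⋯ P_0` is a cascade factorization of `P` over `K` with the given outer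
factors `P_0 = U₂*` and `P_{J+1} = diag(U₁, I_{s-r})`. -/
structure IsCascade (K : Subfield ℂ) {r s : ℕ} (P : LMat r s) (U₁ : LMat r r) (U₂ : LMat s s)
    (J : ℕ) (F : Fin (J + 2) → LMat s s) : Prop where
  coeffs : ∀ j, HasCoeffsIn K (F j)
  paraunitary : IsParaunitary (descProd F)
  product : P = firstRows r s * descProd F
  elementary : ∀ j : Fin (J + 2), 1 ≤ (j : ℕ) → (j : ℕ) ≤ J → IsElementary (F j)
  /-- A symmetry pattern is chosen once for each factor, and the patterns of consecutive factors
  are mutually compatible. -/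
  symm : ∃ S : Fin (J + 2) → Matrix (Fin s) (Fin s) SymType,
    (∀ j, HasSymMatrix (F j) (S j)) ∧
    ∀ j : Fin (J + 1), MutuallyCompatible (S j.succ) (S j.castSucc)
  first : F 0 = mstar U₂
  last : F (Fin.last (J + 1)) = extendById s U₁
  bound : (J : WithBot ℕ) ≤ max 1 (maxHalfLength P)

end SymExt

end

open scoped LaurentPolynomial

noncomputable section

namespace SymExt

open LaurentPolynomial Matrix

/-! ### Coefficients of products -/

/-! Substitute z = w² and shift entry (i, j) by the difference of the pattern exponents (`halve`).
All centres of symmetry move to 0: coefficients at n and -n agree up to the signs of row and column,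
and the exponents of the patterns survive only as a parity condition on powers of w (`IsGraded`).
Products and the involution are preserved, the monomial matrices U become constant, and P has degree
at most 2J in w once every ⌈|cs|/2⌉ is at most J. A factor of degree 2 between patterns with
exponents in {0, -1} is supported in [-1, 1] in z, so each elementary factor has to remove two
degrees.

Let x be the coefficient of w^(-d), d > 0, in row i of Q. Extreme coefficients in QQ* = I, with the
symmetry, give ∑ ε_j |x_j|² = 0; likewise x is orthogonal for this indefinite form to the lowest
coefficients of the other rows. By parity x lives on columns of one exponent. Hence a constant
unitary matrix over the field, respecting patterns, takes x to ρ(e_p + e_q) with opposite signs at p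
and q; square roots are needed for the norm ρ. The block [h, k; k, h] with h = (w + w⁻¹)/2, k = (w -
w⁻¹)/2 is paraunitary and multiplies e_p + e_q by w and e_p - e_q by w⁻¹. It raises the lowest
degree of row i and, by orthogonality, spoils no other row (`exists_rank_one_step`). Repetition
brings every row from degree m to m - 2. The accumulated product B keeps degree at most 2, since
B(QB)* = Q* makes the lowest coefficients of B orthogonal to x as well (`exists_degree_reduction`).

In the end a constant isometry remains. It is completed to a unitary matrix compatibly with the
patterns (`exists_unitary_completion`) and absorbed into the last elementary factor, so it costs no
extra factor (`exists_elementary_chain`); `exists_cascade` adds the outer factors. Conversely, the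
two vectors behind a compatible pattern are unique up to a common monomial, so the patterns of
successive factors can be aligned and multiplied (`exists_hasSymMatrix_revProd`). -/

theorem coeff_mul_eq_sum (p q : ℂ[T;T⁻¹]) (n : ℤ) :
    (p * q).coeff n = ∑ k ∈ p.coeff.support, p.coeff k * q.coeff (n - k) := by
  rw [AddMonoidAlgebra.coeff_mul_apply_left, Finsupp.sum]
  exact Finset.sum_congr rfl fun k _ => by rw [neg_add_eq_sub]

theorem coeff_T_mul (p : ℂ[T;T⁻¹]) (m n : ℤ) : (T m * p).coeff n = p.coeff (n - m) := by
  rw [T, AddMonoidAlgebra.coeff_single_mul_apply, one_mul, neg_add_eq_sub]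

theorem coeff_C_mul (a : ℂ) (p : ℂ[T;T⁻¹]) (n : ℤ) : (C a * p).coeff n = a * p.coeff n := by
  rw [← single_eq_C, AddMonoidAlgebra.coeff_single_mul_apply, neg_zero, zero_add]

theorem coeff_sum_apply {ι : Type*} (s : Finset ι) (f : ι → ℂ[T;T⁻¹]) (n : ℤ) :
    (∑ i ∈ s, f i).coeff n = ∑ i ∈ s, (f i).coeff n := by
  rw [AddMonoidAlgebra.coeff_sum, Finsupp.finsetSum_apply]

theorem coeff_add_apply (p q : ℂ[T;T⁻¹]) (n : ℤ) :
    (p + q).coeff n = p.coeff n + q.coeff n := rfl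

theorem coeff_mul_apply {r s t : ℕ} (M : LMat r s) (N : LMat s t) (i : Fin r) (j : Fin t) (n : ℤ) :
    ((M * N) i j).coeff n = ∑ l, (M i l * N l j).coeff n := by
  rw [Matrix.mul_apply, coeff_sum_apply]

theorem coeff_one_apply {s : ℕ} (i j : Fin s) (n : ℤ) :
    ((1 : LMat s s) i j).coeff n = if i = j ∧ n = 0 then 1 else 0 := by
  by_cases h : i = j
  · subst h
    rw [Matrix.one_apply_eq, ← map_one C, C_apply]
    simp
  · rw [Matrix.one_apply_ne h]
    simp [h]

/-! ### The involution -/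

/-- `pstar` as a ring homomorphism. -/
def pstarHom : ℂ[T;T⁻¹] →+* ℂ[T;T⁻¹] :=
  ((invert (R := ℂ)) : ℂ[T;T⁻¹] →+* ℂ[T;T⁻¹]).comp
    (AddMonoidAlgebra.mapRingHom ℤ (starRingEnd ℂ))

theorem pstarHom_apply (p : ℂ[T;T⁻¹]) : pstarHom p = pstar p := rfl

theorem coeff_pstar (p : ℂ[T;T⁻¹]) (n : ℤ) :
    (pstar p).coeff n = (starRingEnd ℂ) (p.coeff (-n)) := by
  rw [pstar, invert_apply, AddMonoidAlgebra.coeff_mapRingHom]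

theorem pstar_pstar (p : ℂ[T;T⁻¹]) : pstar (pstar p) = p := by
  ext n
  simp [coeff_pstar]

theorem pstar_mul (p q : ℂ[T;T⁻¹]) : pstar (p * q) = pstar p * pstar q := map_mul pstarHom p q

theorem pstar_sum {ι : Type*} (s : Finset ι) (f : ι → ℂ[T;T⁻¹]) :
    pstar (∑ i ∈ s, f i) = ∑ i ∈ s, pstar (f i) := map_sum pstarHom f s

theorem pstar_zero : pstar 0 = 0 := map_zero pstarHom

theorem pstar_one : pstar 1 = 1 := map_one pstarHom

theorem pstar_T (n : ℤ) : pstar (T n) = T (-n) := by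
  ext k
  rw [coeff_pstar, T_apply, T_apply]
  by_cases h : n = -k
  · rw [if_pos h, if_pos (by omega)]; simp
  · rw [if_neg h, if_neg (by omega)]; simp

theorem pstar_C (a : ℂ) : pstar (C a) = C ((starRingEnd ℂ) a) := by
  ext k
  rw [coeff_pstar, C_apply, C_apply]
  by_cases h : k = 0 <;> simp [h]

theorem mstar_mul {r s t : ℕ} (M : LMat r s) (N : LMat s t) :
    mstar (M * N) = mstar N * mstar M := by
  ext1 i j
  simp only [mstar, Matrix.mul_apply, pstar_sum, pstar_mul]
  exact Finset.sum_congr rfl fun _ _ => mul_comm _ _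

theorem mstar_mstar {r s : ℕ} (M : LMat r s) : mstar (mstar M) = M := by
  ext1 i j
  exact pstar_pstar _

theorem mstar_one {s : ℕ} : mstar (1 : LMat s s) = 1 := by
  ext1 i j
  by_cases h : i = j
  · subst h; simp [mstar, pstar_one]
  · simp [mstar, Matrix.one_apply_ne h, Matrix.one_apply_ne (Ne.symm h), pstar_zero]

theorem IsParaunitary.mstar_mul_self {s : ℕ} {M : LMat s s} (h : IsParaunitary M) :
    mstar M * M = 1 := mul_eq_one_comm.mp h

theorem IsParaunitary.mstar {s : ℕ} {M : LMat s s} (h : IsParaunitary M) :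
    IsParaunitary (mstar M) := by
  rw [IsParaunitary, mstar_mstar]; exact h.mstar_mul_self

theorem IsParaunitary.mul {r s t : ℕ} {M : LMat r s} {N : LMat s t} (hM : IsParaunitary M)
    (hN : IsParaunitary N) : IsParaunitary (M * N) := by
  have hN' : N * SymExt.mstar N = 1 := hN
  rw [IsParaunitary, mstar_mul, Matrix.mul_assoc, ← Matrix.mul_assoc N, hN', Matrix.one_mul]
  exact hM

theorem isParaunitary_one {s : ℕ} : IsParaunitary (1 : LMat s s) := by
  rw [IsParaunitary, mstar_one, one_mul]

/-! ### Coefficients in a subfield -/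

section Coefficients

variable {K : Subfield ℂ}

theorem HasCoeffsIn.mul {r s t : ℕ} {M : LMat r s} {N : LMat s t}
    (hM : HasCoeffsIn K M) (hN : HasCoeffsIn K N) : HasCoeffsIn K (M * N) := by
  intro i j k
  rw [coeff_mul_apply]
  refine K.sum_mem fun l _ => ?_
  rw [coeff_mul_eq_sum]
  exact K.sum_mem fun m _ => K.mul_mem (hM _ _ _) (hN _ _ _)

theorem HasCoeffsIn.mstar (hK : IsAdmissibleField K) {r s : ℕ} {M : LMat r s}
    (hM : HasCoeffsIn K M) : HasCoeffsIn K (mstar M) := by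
  intro i j k
  rw [SymExt.mstar, coeff_pstar]
  exact hK.1 _ (hM _ _ _)

theorem hasCoeffsIn_one {s : ℕ} : HasCoeffsIn K (1 : LMat s s) := by
  intro i j k
  rw [coeff_one_apply]
  split_ifs
  exacts [K.one_mem, K.zero_mem]

end Coefficients

/-! ### Symmetry of products -/

theorem sign_mul_self (ε : ℤˣ) : ((ε : ℤ) : ℂ) * ((ε : ℤ) : ℂ) = 1 := by
  rcases Int.units_eq_one_or ε with h | h <;> simp [h]

/-- The functional equation p(z) = ε z^c p(1/z) makes the multiplicativity of patterns a ring
computation. -/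
theorem hasSym_iff (p : ℂ[T;T⁻¹]) (σ : SymType) :
    HasSym p σ ↔ p = C ((σ.sign : ℤ) : ℂ) * (T σ.exp * invert p) := by
  have key : ∀ k, (C ((σ.sign : ℤ) : ℂ) * (T σ.exp * invert p)).coeff k
      = ((σ.sign : ℤ) : ℂ) * p.coeff (σ.exp - k) := fun k => by
    rw [coeff_C_mul, coeff_T_mul, invert_apply, neg_sub]
  constructor
  · intro h
    ext k
    rw [key, h k, ← mul_assoc, sign_mul_self, one_mul]
  · intro h k
    conv_lhs => rw [h]
    rw [key, sub_sub_cancel]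

theorem HasSym.mul {p q : ℂ[T;T⁻¹]} {σ τ : SymType} (hp : HasSym p σ) (hq : HasSym q τ) :
    HasSym (p * q) ⟨σ.sign * τ.sign, σ.exp + τ.exp⟩ := by
  rw [hasSym_iff] at hp hq ⊢
  conv_lhs => rw [hp, hq]
  simp only [Units.val_mul, Int.cast_mul, map_mul, T_add]
  ring

theorem HasSym.sum {ι : Type*} {s : Finset ι} {f : ι → ℂ[T;T⁻¹]} {σ : SymType}
    (h : ∀ i ∈ s, HasSym (f i) σ) : HasSym (∑ i ∈ s, f i) σ := by
  intro k
  rw [coeff_sum_apply, coeff_sum_apply, Finset.mul_sum]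
  exact Finset.sum_congr rfl fun i hi => h i hi k

theorem HasSym.pstar {p : ℂ[T;T⁻¹]} {σ : SymType} (h : HasSym p σ) :
    HasSym (pstar p) ⟨σ.sign, -σ.exp⟩ := by
  intro k
  rw [coeff_pstar, coeff_pstar, show -(-σ.exp - k) = σ.exp - -k by ring, h (-k)]
  simp

theorem hasSym_zero (σ : SymType) : HasSym 0 σ := fun k => by simp

/-- The middle pattern cancels: its sign occurs squared and its exponents telescope, so all summands
of an entry share one pattern. -/
theorem HasSymMatrix.mul {r s t : ℕ} {M : LMat r s} {N : LMat s t} {ρ : Fin r → SymType}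
    {σ : Fin s → SymType} {τ : Fin t → SymType} (hM : HasSymMatrix M (starMul ρ σ))
    (hN : HasSymMatrix N (starMul σ τ)) : HasSymMatrix (M * N) (starMul ρ τ) := by
  intro i j
  rw [Matrix.mul_apply]
  refine HasSym.sum fun l _ => ?_
  have h := (hM i l).mul (hN l j)
  have e : (⟨(starMul ρ σ i l).sign * (starMul σ τ l j).sign,
      (starMul ρ σ i l).exp + (starMul σ τ l j).exp⟩ : SymType) = starMul ρ τ i j := by
    simp only [starMul, SymType.mk.injEq]
    constructor
    · rw [mul_mul_mul_comm, mul_comm (ρ i).sign, mul_assoc, ← mul_assoc (ρ i).sign]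
      rw [mul_left_comm, mul_assoc, ← mul_assoc (σ l).sign, Int.units_mul_self, one_mul]
    · ring
  rwa [e] at h

theorem HasSymMatrix.mstar {r s : ℕ} {M : LMat r s} {ρ : Fin r → SymType}
    {σ : Fin s → SymType} (hM : HasSymMatrix M (starMul ρ σ)) :
    HasSymMatrix (mstar M) (starMul σ ρ) := by
  intro j i
  have h := (hM i j).pstar
  have e : (⟨(starMul ρ σ i j).sign, -(starMul ρ σ i j).exp⟩ : SymType) = starMul σ ρ j i := by
    simp only [starMul, SymType.mk.injEq]
    exact ⟨mul_comm _ _, by ring⟩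
  rwa [e] at h

theorem hasSymMatrix_one {s : ℕ} (σ : Fin s → SymType) :
    HasSymMatrix (1 : LMat s s) (starMul σ σ) := by
  intro i j k
  rw [coeff_one_apply, coeff_one_apply]
  by_cases h : i = j
  · subst h
    simp [starMul]
  · simp [h]

/-! ### Unitary matrices over the subfield -/

section Unitary

variable {K : Subfield ℂ}

theorem vecMul_vecMulVec {s : ℕ} (x a b : Fin s → ℂ) :
    x ᵥ* vecMulVec a b = (x ⬝ᵥ a) • b := by
  ext j
  simp only [vecMul, dotProduct, vecMulVec_apply, Pi.smul_apply, smul_eq_mul, Finset.sum_mul,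
    mul_assoc]

/-- A unitary matrix over `K` that maps the unit vector `u` to a basis vector `e` and fixes the
orthogonal complement of `u` and `e`. -/
theorem exists_unitary_vecMul_eq_single (hK : IsAdmissibleField K) {s : ℕ} (u : Fin s → ℂ)
    (hu : ∀ j, u j ∈ K) (h1 : u ⬝ᵥ star u = 1) (j₀ : Fin s) :
    ∃ R : Matrix (Fin s) (Fin s) ℂ, R * Rᴴ = 1 ∧ (∀ i j, R i j ∈ K) ∧
      u ᵥ* R = Pi.single j₀ 1 ∧ (∀ x, x ⬝ᵥ star u = 0 → x j₀ = 0 → x ᵥ* R = x) ∧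
      ∀ i j, R i j ≠ 0 → i = j ∨ ((u i ≠ 0 ∨ i = j₀) ∧ (u j ≠ 0 ∨ j = j₀)) := by
  -- A complex Householder matrix along v = u - e, with factor 1/(1 - u_{j₀}): it sends u exactly to
  -- e, without a phase and without square roots, so it stays over `K`. It differs from the identity
  -- only where v is nonzero.
  set v : Fin s → ℂ := u - Pi.single j₀ 1 with hv
  have hsv : star v = star u - Pi.single j₀ 1 := by
    rw [hv, star_sub, ← Pi.single_star, star_one]
  have hvK : ∀ j, v j ∈ K := fun j => by
    rw [hv, Pi.sub_apply, Pi.single_apply]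
    split_ifs
    exacts [K.sub_mem (hu j) K.one_mem, K.sub_mem (hu j) K.zero_mem]
  have hv0 : ∀ j, v j ≠ 0 → u j ≠ 0 ∨ j = j₀ := fun j hj => by
    by_contra! h
    exact hj (by rw [hv, Pi.sub_apply, h.1, Pi.single_eq_of_ne h.2, sub_zero])
  have huv : u ⬝ᵥ star v = 1 - u j₀ := by
    rw [hsv, dotProduct_sub, h1, dotProduct_single, mul_one]
  have hvv : v ⬝ᵥ star v = (1 - u j₀) + (1 - star (u j₀)) := by
    rw [hv, sub_dotProduct, ← hv, huv, hsv, dotProduct_sub, single_dotProduct, single_dotProduct]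
    simp
    ring
  by_cases h0 : u j₀ = 1
  · have hv' : v = 0 := by
      open scoped ComplexOrder in rw [← dotProduct_self_star_eq_zero, hvv, h0]
      simp
    refine ⟨1, by simp, fun i j => ?_, ?_, fun x _ _ => vecMul_one x, fun i j h => ?_⟩
    · rw [Matrix.one_apply]
      split_ifs
      exacts [K.one_mem, K.zero_mem]
    · rw [vecMul_one]
      exact sub_eq_zero.mp (hv ▸ hv')
    · by_contra! h'
      exact h (Matrix.one_apply_ne h'.1)
  have h0' : 1 - u j₀ ≠ 0 := sub_ne_zero.mpr (Ne.symm h0)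
  have h0s : 1 - star (u j₀) ≠ 0 := by
    have := star_ne_zero.mpr h0'
    rwa [star_sub, star_one] at this
  have hR : ∀ x, x ᵥ* (1 - (1 - u j₀)⁻¹ • vecMulVec (star v) v)
      = x - ((1 - u j₀)⁻¹ * (x ⬝ᵥ star v)) • v := fun x => by
    rw [vecMul_sub, vecMul_one, vecMul_smul, vecMul_vecMulVec, smul_smul]
  refine ⟨1 - (1 - u j₀)⁻¹ • vecMulVec (star v) v, ?_, fun i j => ?_, ?_, fun x hx hx0 => ?_,
    fun i j h => ?_⟩
  · have hP : (vecMulVec (star v) v)ᴴ = vecMulVec (star v) v := by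
      rw [conjTranspose_vecMulVec, star_star]
    have hPP : vecMulVec (star v) v * vecMulVec (star v) v
        = ((1 - u j₀) + (1 - star (u j₀))) • vecMulVec (star v) v := by
      rw [vecMulVec_mul_vecMulVec, hvv, vecMulVec_smul]
    rw [conjTranspose_sub, conjTranspose_smul, hP, conjTranspose_one, Matrix.sub_mul, Matrix.one_mul,
      Matrix.mul_sub, Matrix.mul_one, Matrix.smul_mul, Matrix.mul_smul, hPP, smul_smul, smul_smul,
      sub_sub, ← add_sub_assoc, ← add_smul, ← sub_smul, star_inv₀, star_sub, star_one]
    -- Unitarity comes down to |v|² = (1 - u_{j₀}) + (1 - conj u_{j₀}).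
    have : (1 - star (u j₀))⁻¹ + (1 - u j₀)⁻¹ - (1 - u j₀)⁻¹ * (1 - star (u j₀))⁻¹ *
        (1 - u j₀ + (1 - star (u j₀))) = 0 := by
      field_simp
      ring
    rw [this, zero_smul, sub_zero]
  · rw [Matrix.sub_apply, Matrix.smul_apply, vecMulVec_apply, Matrix.one_apply, smul_eq_mul]
    refine K.sub_mem ?_ (K.mul_mem (K.inv_mem (K.sub_mem K.one_mem (hu _)))
      (K.mul_mem (hK.1 _ (hvK i)) (hvK j)))
    split_ifs
    exacts [K.one_mem, K.zero_mem]
  · rw [hR, huv, inv_mul_cancel₀ h0', one_smul, hv, sub_sub_cancel]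
  · rw [hR, hsv, dotProduct_sub, hx, dotProduct_single, hx0]
    simp
  · by_contra! h'
    refine h ?_
    rw [Matrix.sub_apply, Matrix.smul_apply, vecMulVec_apply, Matrix.one_apply_ne h'.1]
    have : v i = 0 ∨ v j = 0 := by
      by_contra! hc
      have h2 := h'.2 (hv0 i hc.1)
      exact (hv0 j hc.2).elim (fun h => h h2.1) h2.2
    rcases this with h | h <;> simp [h]

/-- The matrix `V` maps the class `ρ i` into the class `σ j` only where the classes agree. -/
def Respects {α : Type*} {r s : ℕ} (ρ : Fin r → α) (σ : Fin s → α)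
    (V : Matrix (Fin r) (Fin s) ℂ) : Prop :=
  ∀ i j, V i j ≠ 0 → ρ i = σ j

theorem Respects.mul {α : Type*} {r s t : ℕ} {ρ : Fin r → α} {σ : Fin s → α} {τ : Fin t → α}
    {V : Matrix (Fin r) (Fin s) ℂ} {W : Matrix (Fin s) (Fin t) ℂ} (hV : Respects ρ σ V)
    (hW : Respects σ τ W) : Respects ρ τ (V * W) := by
  intro i j h
  rw [Matrix.mul_apply] at h
  obtain ⟨l, -, hl⟩ := Finset.exists_ne_zero_of_sum_ne_zero h
  exact (hV i l (left_ne_zero_of_mul hl)).trans (hW l j (right_ne_zero_of_mul hl))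

theorem mul_mem_matrix {r s t : ℕ} {V : Matrix (Fin r) (Fin s) ℂ} {W : Matrix (Fin s) (Fin t) ℂ}
    (hV : ∀ i j, V i j ∈ K) (hW : ∀ i j, W i j ∈ K) (i : Fin r) (j : Fin t) :
    (V * W) i j ∈ K := by
  rw [Matrix.mul_apply]
  exact K.sum_mem fun l _ => K.mul_mem (hV i l) (hW l j)

theorem mul_conjTranspose_mul_of_unitary {r s : ℕ} {V : Matrix (Fin r) (Fin s) ℂ}
    {W : Matrix (Fin s) (Fin s) ℂ} (hV : V * Vᴴ = 1) (hW : W * Wᴴ = 1) :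
    (V * W) * (V * W)ᴴ = 1 := by
  rw [conjTranspose_mul, Matrix.mul_assoc, ← Matrix.mul_assoc W, hW, Matrix.one_mul, hV]

/-- Gaussian elimination by reflections, one row at a time. A row already equal to a basis vector is
orthogonal to the next row u, so u vanishes at that position and the reflection fixes the finished
row. The target position is taken in the support of u, which lies in a single class, so classes are
respected. -/
theorem exists_unitary_rows_eq_single {α : Type*} (hK : IsAdmissibleField K) {r s : ℕ}
    {C : Matrix (Fin r) (Fin s) ℂ} (hC : C * Cᴴ = 1) (hCK : ∀ i j, C i j ∈ K)
    {a : Fin r → α} {b : Fin s → α} (hab : Respects a b C) (k : ℕ) :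
    ∃ (W : Matrix (Fin s) (Fin s) ℂ), W * Wᴴ = 1 ∧ (∀ i j, W i j ∈ K) ∧ Respects b b W ∧
      ∀ i : Fin r, (i : ℕ) < k → ∃ j, (C * W) i = Pi.single j 1 := by
  induction k with
  | zero =>
    refine ⟨1, by simp, fun i j => ?_, fun i j h => ?_, fun i hi => absurd hi (Nat.not_lt_zero _)⟩
    · rw [Matrix.one_apply]
      split_ifs
      exacts [K.one_mem, K.zero_mem]
    · by_contra h'
      exact h (Matrix.one_apply_ne fun h => h' (congrArg b h))
  | succ k ih =>
    obtain ⟨W, hW, hWK, hWb, hrows⟩ := ih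
    by_cases hk : k < r
    swap
    · exact ⟨W, hW, hWK, hWb, fun i hi => hrows i (by omega)⟩
    have hCW := mul_conjTranspose_mul_of_unitary hC hW
    have horth : ∀ i i', (C * W) i ⬝ᵥ star ((C * W) i') = if i = i' then 1 else 0 := fun i i' => by
      rw [← Matrix.one_apply, ← hCW]; rfl
    set u := (C * W) ⟨k, hk⟩ with hu
    have h1 : u ⬝ᵥ star u = 1 := by rw [hu, horth, if_pos rfl]
    obtain ⟨j₀, hj₀⟩ : ∃ j, u j ≠ 0 := by
      by_contra! h
      rw [show u = 0 from funext h, zero_dotProduct] at h1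
      exact zero_ne_one h1
    have hub : ∀ j, u j ≠ 0 → a ⟨k, hk⟩ = b j := fun j hj => (hab.mul hWb) _ _ hj
    obtain ⟨R, hR, hRK, huR, hfix, hR0⟩ :=
      exists_unitary_vecMul_eq_single hK u (mul_mem_matrix hCK hWK _) h1 j₀
    have hrow : ∀ i, (C * (W * R)) i = (C * W) i ᵥ* R := fun i => by
      rw [← Matrix.mul_assoc]; rfl
    have hclass : ∀ j, u j ≠ 0 ∨ j = j₀ → a ⟨k, hk⟩ = b j := by
      rintro j (h | rfl)
      exacts [hub j h, hub j hj₀]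
    refine ⟨W * R, mul_conjTranspose_mul_of_unitary hW hR, mul_mem_matrix hWK hRK,
      hWb.mul fun i j h => ?_, fun i hi => ?_⟩
    · rcases hR0 i j h with h | ⟨h, h'⟩
      exacts [congrArg b h, (hclass i h).symm.trans (hclass j h')]
    · rcases Nat.lt_succ_iff_lt_or_eq.mp hi with hi | hi
      · obtain ⟨j, hj⟩ := hrows i hi
        refine ⟨j, ?_⟩
        have ho : (C * W) i ⬝ᵥ star u = 0 := by
          rw [hu, horth, if_neg]
          rintro rfl
          exact lt_irrefl _ hi
        have huj : u j = 0 := by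
          rw [hj, single_dotProduct, one_mul] at ho
          exact star_eq_zero.mp ho
        rw [hrow, hfix _ ho, hj]
        rw [hj, Pi.single_eq_of_ne]
        rintro rfl
        exact hj₀ huj
      · have : i = ⟨k, hk⟩ := Fin.ext hi
        exact ⟨j₀, by rw [hrow, this, ← hu, huR]⟩

/-- Completion of an `r × s` isometry to a unitary matrix over `K`, compatibly with classes. -/
theorem exists_unitary_completion {α : Type*} (hK : IsAdmissibleField K) {r s : ℕ} (hrs : r ≤ s)
    {C : Matrix (Fin r) (Fin s) ℂ} (hC : C * Cᴴ = 1) (hCK : ∀ i j, C i j ∈ K)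
    {a : Fin r → α} {b : Fin s → α} (hab : Respects a b C) :
    ∃ (V : Matrix (Fin s) (Fin s) ℂ) (τ : Fin s → α), V * Vᴴ = 1 ∧ (∀ i j, V i j ∈ K) ∧
      Respects τ b V ∧ (∀ i, V (Fin.castLE hrs i) = C i) ∧ ∀ i, τ (Fin.castLE hrs i) = a i := by
  obtain ⟨W, hW, hWK, hWb, hrows⟩ := exists_unitary_rows_eq_single hK hC hCK hab r
  choose f hf using fun i : Fin r => hrows i i.2
  have hCW := mul_conjTranspose_mul_of_unitary hC hW
  have horth : ∀ i i', (C * W) i ⬝ᵥ star ((C * W) i') = if i = i' then 1 else 0 := fun i i' => by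
    rw [← Matrix.one_apply, ← hCW]; rfl
  have hinj : Function.Injective f := fun i i' h => by
    by_contra hne
    have := horth i i'
    rw [hf, hf, if_neg hne, h, single_dotProduct, Pi.star_apply, Pi.single_eq_same] at this
    simp at this
  have hWW : Wᴴ * W = 1 := mul_eq_one_comm.mp hW
  have hcast : Function.Injective (Fin.castLE hrs) := Fin.castLE_injective hrs
  obtain ⟨π, hπ⟩ : ∃ π : Equiv.Perm (Fin s), ∀ i, π (Fin.castLE hrs i) = f i := by
    classical
    let e : {x // x ∈ Set.range (Fin.castLE hrs)} ≃ {x // x ∈ Set.range f} :=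
      (Equiv.ofInjective _ hcast).symm.trans (Equiv.ofInjective f hinj)
    refine ⟨e.extendSubtype, fun i => ?_⟩
    rw [Equiv.extendSubtype_apply_of_mem e _ ⟨i, rfl⟩]
    simp [e]
  -- Row f i of Wᴴ is row i of (C W) Wᴴ = C. Permuting the rows of Wᴴ puts these first, and the
  -- remaining rows are the completion.
  refine ⟨Wᴴ.submatrix π id, b ∘ π, ?_, fun i j => hK.1 _ (hWK _ _), fun i j h => ?_,
    fun i => ?_, fun i => ?_⟩
  · have h := congrArg (fun M => M.submatrix π π) hWW
    simp only [Matrix.submatrix_one_equiv] at h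
    rw [← h]
    ext i j
    simp [Matrix.mul_apply]
  · refine (hWb j (π i) fun h0 => h ?_).symm
    rw [submatrix_apply, conjTranspose_apply, id, h0, star_zero]
  · have : C * W * Wᴴ = C := by rw [Matrix.mul_assoc, hW, Matrix.mul_one]
    ext j
    rw [submatrix_apply, hπ]
    conv_rhs => rw [← this, Matrix.mul_apply_eq_vecMul, hf, single_one_vecMul]
    rfl
  · have h := hab.mul hWb i (f i)
    rw [Function.comp_apply, hπ]
    refine (h ?_).symm
    rw [hf, Pi.single_eq_same]
    exact one_ne_zero

end Unitary

/-! ### Isotropic vectors -/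

section Isotropic

variable {K : Subfield ℂ}

theorem vecMul_dotProduct_star_vecMul {s : ℕ} {V : Matrix (Fin s) (Fin s) ℂ} (hV : V * Vᴴ = 1)
    (x y : Fin s → ℂ) : (y ᵥ* V) ⬝ᵥ star (x ᵥ* V) = y ⬝ᵥ star x := by
  rw [star_vecMul, dotProduct_mulVec, vecMul_vecMul, hV, vecMul_one]

/-- Normalization of a nonzero vector over `K`. -/
theorem exists_inv_norm (hK : IsAdmissibleField K) {s : ℕ} {w : Fin s → ℂ} (hw : w ≠ 0)
    (hwK : ∀ j, w j ∈ K) :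
    ∃ ρ : ℝ, 0 < ρ ∧ (ρ : ℂ) ∈ K ∧ w ⬝ᵥ star w = (ρ : ℂ) * (ρ : ℂ) := by
  have hN : w ⬝ᵥ star w = ((∑ j, Complex.normSq (w j) : ℝ) : ℂ) := by
    rw [dotProduct, Complex.ofReal_sum]
    exact Finset.sum_congr rfl fun j _ => Complex.mul_conj (w j)
  have hpos : 0 < ∑ j, Complex.normSq (w j) := by
    obtain ⟨j, hj⟩ := Function.ne_iff.mp hw
    exact Finset.sum_pos' (fun _ _ => Complex.normSq_nonneg _)
      ⟨j, Finset.mem_univ j, Complex.normSq_pos.mpr hj⟩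
  refine ⟨√(∑ j, Complex.normSq (w j)), Real.sqrt_pos.mpr hpos, hK.2 _ hpos ?_, ?_⟩
  · rw [← hN]
    exact K.sum_mem fun j _ => K.mul_mem (hwK j) (hK.1 _ (hwK j))
  · rw [hN, ← Complex.ofReal_mul, Real.mul_self_sqrt hpos.le]

theorem star_dotProduct_comm_ofReal {s : ℕ} (ρ : ℝ) (y w : Fin s → ℂ) :
    y ⬝ᵥ star ((ρ : ℂ)⁻¹ • w) = (ρ : ℂ)⁻¹ * (y ⬝ᵥ star w) := by
  rw [star_smul, dotProduct_smul, smul_eq_mul, star_inv₀]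
  congr 2
  exact Complex.conj_ofReal ρ

/-- A vector that is isotropic for the signs of `σ` and supported on a single exponent can be
rotated, compatibly with `σ`, to a multiple of the sum of two basis vectors. -/
theorem exists_unitary_isotropic (hK : IsAdmissibleField K) {s : ℕ} (σ : Fin s → SymType)
    {x : Fin s → ℂ} (hx : x ≠ 0) (hxK : ∀ j, x j ∈ K) {e : ℤ}
    (hxe : ∀ j, x j ≠ 0 → (σ j).exp = e)
    (hiso : ∑ j, (((σ j).sign : ℤ) : ℂ) * (x j * star (x j)) = 0) :
    ∃ (V : Matrix (Fin s) (Fin s) ℂ) (ρ : ℂ) (p q : Fin s), V * Vᴴ = 1 ∧ (∀ i j, V i j ∈ K) ∧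
      Respects σ σ V ∧ σ p = ⟨1, e⟩ ∧ σ q = ⟨-1, e⟩ ∧
      x ᵥ* V = ρ • (Pi.single p 1 + Pi.single q 1) ∧
      ∀ y, ∑ j, (((σ j).sign : ℤ) : ℂ) * (y j * star (x j)) = 0 → (y ᵥ* V) p = (y ᵥ* V) q := by
  set a : Fin s → ℂ := fun j => if (σ j).sign = 1 then x j else 0 with ha
  set b : Fin s → ℂ := fun j => if (σ j).sign = 1 then 0 else x j with hb
  have hsplit : ∀ y : Fin s → ℂ, ∑ j, (((σ j).sign : ℤ) : ℂ) * (y j * star (x j))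
      = y ⬝ᵥ star a - y ⬝ᵥ star b := fun y => by
    rw [dotProduct, dotProduct, ← Finset.sum_sub_distrib]
    refine Finset.sum_congr rfl fun j _ => ?_
    rcases Int.units_eq_one_or (σ j).sign with h | h <;> simp [ha, hb, h]
  have hxab : x = a + b := by
    ext j
    by_cases h : (σ j).sign = 1 <;> simp [ha, hb, h]
  have hab : a ⬝ᵥ star b = 0 := Finset.sum_eq_zero fun j _ => by
    by_cases h : (σ j).sign = 1 <;> simp [ha, hb, h]
  have hba : b ⬝ᵥ star a = 0 := Finset.sum_eq_zero fun j _ => by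
    by_cases h : (σ j).sign = 1 <;> simp [ha, hb, h]
  have haK : ∀ j, a j ∈ K := fun j => by
    simp only [ha]; split_ifs; exacts [hxK j, K.zero_mem]
  have hbK : ∀ j, b j ∈ K := fun j => by
    simp only [hb]; split_ifs; exacts [K.zero_mem, hxK j]
  -- Isotropy says that the positive part a and the negative part b have equal norm, so one scalar ρ
  -- normalizes both. They have disjoint supports, so one reflection for each does not disturb the
  -- other.
  have hnorm : a ⬝ᵥ star a = b ⬝ᵥ star b := by
    have h := hsplit x
    rw [hiso] at h
    conv_rhs at h => rw [hxab, add_dotProduct, add_dotProduct, hab, hba, add_zero, zero_add]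
    exact sub_eq_zero.mp h.symm
  have ha0 : a ≠ 0 := fun h => hx <| by
    have hb0 : b ⬝ᵥ star b = 0 := by rw [← hnorm, h, zero_dotProduct]
    open scoped ComplexOrder in rw [dotProduct_self_star_eq_zero] at hb0
    rw [hxab, h, hb0, add_zero]
  obtain ⟨ρ, hρ, hρK, hρa⟩ := exists_inv_norm hK ha0 haK
  have hρ0 : (ρ : ℂ) ≠ 0 := Complex.ofReal_ne_zero.mpr hρ.ne'
  have hunit : ∀ w : Fin s → ℂ, w ⬝ᵥ star w = (ρ : ℂ) * (ρ : ℂ) →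
      ((ρ : ℂ)⁻¹ • w) ⬝ᵥ star ((ρ : ℂ)⁻¹ • w) = 1 := fun w hw => by
    rw [star_dotProduct_comm_ofReal, smul_dotProduct, hw, smul_eq_mul]
    field_simp
  have hscK : ∀ w : Fin s → ℂ, (∀ j, w j ∈ K) → ∀ j, ((ρ : ℂ)⁻¹ • w) j ∈ K := fun w hw j =>
    K.mul_mem (K.inv_mem hρK) (hw j)
  have hne : ∀ w : Fin s → ℂ, w ⬝ᵥ star w = (ρ : ℂ) * (ρ : ℂ) → ∃ j, w j ≠ 0 := fun w hw => by
    by_contra! h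
    rw [show w = 0 from funext h, zero_dotProduct] at hw
    exact mul_ne_zero hρ0 hρ0 hw.symm
  have hasupp : ∀ j, a j ≠ 0 → σ j = ⟨1, e⟩ := fun j hj => by
    simp only [ha, ne_eq, ite_eq_right_iff, Classical.not_imp] at hj
    rw [← hj.1, ← hxe j hj.2]
  have hbsupp : ∀ j, b j ≠ 0 → σ j = ⟨-1, e⟩ := fun j hj => by
    simp only [hb, ne_eq, ite_eq_left_iff, Classical.not_imp] at hj
    rw [← (Int.units_eq_one_or (σ j).sign).resolve_left hj.1, ← hxe j hj.2]
  obtain ⟨p, hp⟩ := hne a hρa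
  obtain ⟨q, hq⟩ := hne b (hnorm ▸ hρa)
  have hσp := hasupp p hp
  have hσq := hbsupp q hq
  have hbp : b p = 0 := by simp [hb, hσp]
  have haq : a q = 0 := by simp [ha, hσq]
  have hpq : p ≠ q := fun h => hp (h ▸ haq)
  obtain ⟨R, hR, hRK, haR, hRfix, hR0⟩ :=
    exists_unitary_vecMul_eq_single hK _ (hscK a haK) (hunit a hρa) p
  obtain ⟨S, hS, hSK, hbS, hSfix, hS0⟩ :=
    exists_unitary_vecMul_eq_single hK _ (hscK b hbK) (hunit b (hnorm ▸ hρa)) q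
  have hV := mul_conjTranspose_mul_of_unitary hR hS
  have hRσ : Respects σ σ R := fun i j h => by
    have hc : ∀ j, ((ρ : ℂ)⁻¹ • a) j ≠ 0 ∨ j = p → σ j = ⟨1, e⟩ := by
      rintro j (h | rfl)
      exacts [hasupp j (right_ne_zero_of_mul h), hσp]
    rcases hR0 i j h with h | ⟨h, h'⟩
    exacts [congrArg σ h, (hc i h).trans (hc j h').symm]
  have hSσ : Respects σ σ S := fun i j h => by
    have hc : ∀ j, ((ρ : ℂ)⁻¹ • b) j ≠ 0 ∨ j = q → σ j = ⟨-1, e⟩ := by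
      rintro j (h | rfl)
      exacts [hbsupp j (right_ne_zero_of_mul h), hσq]
    rcases hS0 i j h with h | ⟨h, h'⟩
    exacts [congrArg σ h, (hc i h).trans (hc j h').symm]
  have haV : ((ρ : ℂ)⁻¹ • a) ᵥ* (R * S) = Pi.single p 1 := by
    rw [← vecMul_vecMul, haR]
    refine hSfix _ ?_ (Pi.single_eq_of_ne hpq.symm _)
    rw [star_dotProduct_comm_ofReal, single_dotProduct, Pi.star_apply, hbp]
    simp
  have hbV : ((ρ : ℂ)⁻¹ • b) ᵥ* (R * S) = Pi.single q 1 := by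
    rw [← vecMul_vecMul, hRfix, hbS]
    · rw [star_dotProduct_comm_ofReal, smul_dotProduct, hba]
      simp
    · rw [Pi.smul_apply, hbp, smul_zero]
  refine ⟨R * S, ρ, p, q, hV, mul_mem_matrix hRK hSK, hRσ.mul hSσ, hσp, hσq, ?_, fun y hy => ?_⟩
  · rw [← haV, ← hbV, ← add_vecMul, ← smul_add, ← hxab, smul_vecMul, smul_smul,
      mul_inv_cancel₀ hρ0, one_smul]
  · have h1 := vecMul_dotProduct_star_vecMul hV ((ρ : ℂ)⁻¹ • a) y
    have h2 := vecMul_dotProduct_star_vecMul hV ((ρ : ℂ)⁻¹ • b) y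
    rw [haV, ← Pi.single_star, dotProduct_single, star_one, mul_one,
      star_dotProduct_comm_ofReal] at h1
    rw [hbV, ← Pi.single_star, dotProduct_single, star_one, mul_one,
      star_dotProduct_comm_ofReal] at h2
    rw [hsplit, sub_eq_zero] at hy
    rw [h1, h2, hy]

end Isotropic

/-! ### Graded matrices

After the substitution `z = w²` and a shift of the entries, all symmetry patterns have exponent
`0`, and the exponents of the patterns only constrain the parity of the exponents of `w`. -/

/-- The signs of a pattern vector. -/
def signPattern {s : ℕ} (σ : Fin s → SymType) : Fin s → SymType := fun i => ⟨(σ i).sign, 0⟩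

/-- The symmetry and parity constraints on a Laurent matrix in `w = z^{1/2}`. -/
structure IsGraded {r s : ℕ} (ρ : Fin r → SymType) (σ : Fin s → SymType) (M : LMat r s) :
    Prop where
  symm : HasSymMatrix M (starMul (signPattern ρ) (signPattern σ))
  parity : ∀ i j n, (M i j).coeff n ≠ 0 → 2 ∣ n + (σ j).exp - (ρ i).exp

theorem IsGraded.coeff_neg {r s : ℕ} {ρ : Fin r → SymType} {σ : Fin s → SymType} {M : LMat r s}
    (h : IsGraded ρ σ M) (i : Fin r) (j : Fin s) (n : ℤ) :
    (M i j).coeff (-n) = (((ρ i).sign : ℤ) : ℂ) * (((σ j).sign : ℤ) : ℂ) * (M i j).coeff n := by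
  have := h.symm i j n
  simpa [starMul, signPattern] using this

theorem IsGraded.mul {r s t : ℕ} {ρ : Fin r → SymType} {σ : Fin s → SymType} {τ : Fin t → SymType}
    {M : LMat r s} {N : LMat s t} (hM : IsGraded ρ σ M) (hN : IsGraded σ τ N) :
    IsGraded ρ τ (M * N) := by
  refine ⟨hM.symm.mul hN.symm, fun i j n h => ?_⟩
  rw [coeff_mul_apply] at h
  obtain ⟨l, -, hl⟩ := Finset.exists_ne_zero_of_sum_ne_zero h
  rw [coeff_mul_eq_sum] at hl
  obtain ⟨k, -, hk⟩ := Finset.exists_ne_zero_of_sum_ne_zero hl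
  have h1 := hM.parity i l k (left_ne_zero_of_mul hk)
  have h2 := hN.parity l j (n - k) (right_ne_zero_of_mul hk)
  have := dvd_add h1 h2
  rwa [show k + (σ l).exp - (ρ i).exp + (n - k + (τ j).exp - (σ l).exp)
    = n + (τ j).exp - (ρ i).exp by ring] at this

theorem isGraded_one {s : ℕ} (σ : Fin s → SymType) : IsGraded σ σ (1 : LMat s s) := by
  refine ⟨hasSymMatrix_one _, fun i j n h => ?_⟩
  rw [coeff_one_apply] at h
  simp only [ne_eq, ite_eq_right_iff, one_ne_zero, imp_false, not_not] at h
  rw [h.1, h.2]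
  simp

/-! ### Constant matrices -/

theorem coeff_mul_map_C {r s t : ℕ} (M : LMat r s) (V : Matrix (Fin s) (Fin t) ℂ) (i : Fin r)
    (n : ℤ) : (fun j => ((M * V.map C) i j).coeff n) = (fun l => (M i l).coeff n) ᵥ* V := by
  ext j
  rw [coeff_mul_apply]
  simp only [vecMul, dotProduct, map_apply]
  exact Finset.sum_congr rfl fun l _ => by rw [mul_comm, coeff_C_mul, mul_comm]

theorem mstar_map_C {r s : ℕ} (V : Matrix (Fin r) (Fin s) ℂ) :
    mstar (V.map C) = Vᴴ.map C := by
  ext1 i j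
  exact pstar_C _

theorem isParaunitary_map_C {r s : ℕ} {V : Matrix (Fin r) (Fin s) ℂ} (hV : V * Vᴴ = 1) :
    IsParaunitary (V.map C) := by
  rw [IsParaunitary, mstar_map_C, ← Matrix.map_mul, hV, Matrix.map_one _ (map_zero _) (map_one _)]

theorem hasCoeffsIn_map_C {K : Subfield ℂ} {r s : ℕ} {V : Matrix (Fin r) (Fin s) ℂ}
    (hV : ∀ i j, V i j ∈ K) : HasCoeffsIn K (V.map C) := by
  intro i j k
  rw [map_apply, C_apply]
  split_ifs
  exacts [hV i j, K.zero_mem]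

theorem Respects.hasSymMatrix_map_C {r s : ℕ} {ρ : Fin r → SymType} {σ : Fin s → SymType}
    {V : Matrix (Fin r) (Fin s) ℂ} (hV : Respects ρ σ V) :
    HasSymMatrix (V.map C) (starMul ρ σ) := by
  intro i j k
  rw [map_apply]
  by_cases h : V i j = 0
  · simp [h]
  · simp [starMul, hV i j h, C_apply]

theorem Respects.isGraded_map_C {r s : ℕ} {ρ : Fin r → SymType} {σ : Fin s → SymType}
    {V : Matrix (Fin r) (Fin s) ℂ} (hV : Respects ρ σ V) : IsGraded ρ σ (V.map C) := by
  refine ⟨Respects.hasSymMatrix_map_C fun i j h => ?_, fun i j n h => ?_⟩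
  · rw [signPattern, signPattern, hV i j h]
  · rw [map_apply, C_apply] at h
    simp only [ne_eq, ite_eq_right_iff, Classical.not_imp] at h
    rw [hV i j h.2, h.1]
    simp

/-! ### The butterfly matrix -/

/-- `(w + w⁻¹) / 2`. -/
def halfSum : ℂ[T;T⁻¹] := C (1 / 2) * (T 1 + T (-1))

/-- `(w - w⁻¹) / 2`. -/
def halfDiff : ℂ[T;T⁻¹] := C (1 / 2) * (T 1 - T (-1))

theorem pstar_halfSum : pstar halfSum = halfSum := by
  rw [← pstarHom_apply, halfSum, map_mul, map_add]
  simp only [pstarHom_apply, pstar_C, pstar_T, neg_neg]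
  rw [add_comm (T (-1)), map_div₀, map_one, map_ofNat]

theorem pstar_halfDiff : pstar halfDiff = -halfDiff := by
  rw [← pstarHom_apply, halfDiff, map_mul, map_sub]
  simp only [pstarHom_apply, pstar_C, pstar_T, neg_neg]
  rw [← mul_neg, neg_sub, map_div₀, map_one, map_ofNat]

/-- The Laurent form of cosh² - sinh² = 1. Since the involution fixes `halfSum` and negates
`halfDiff`, this is the paraunitarity of the block. -/
theorem halfSum_sq_sub_halfDiff_sq : halfSum * halfSum - halfDiff * halfDiff = 1 := by
  have h : (T 1 * T (-1) : ℂ[T;T⁻¹]) = 1 := by rw [← T_add]; simp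
  have h4 : (C (1 / 2) * C (1 / 2) * 4 : ℂ[T;T⁻¹]) = 1 := by
    rw [← map_ofNat C 4, ← map_mul, ← map_mul]
    norm_num
  rw [halfSum, halfDiff]
  linear_combination (C (1 / 2) * C (1 / 2) * 4 : ℂ[T;T⁻¹]) * h + h4

theorem coeff_mul_halfSum (p : ℂ[T;T⁻¹]) (n : ℤ) :
    (p * halfSum).coeff n = (p.coeff (n - 1) + p.coeff (n + 1)) / 2 := by
  rw [halfSum, mul_left_comm, coeff_C_mul, mul_add, coeff_add_apply, mul_comm p, mul_comm p,
    coeff_T_mul, coeff_T_mul, sub_neg_eq_add]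
  ring

theorem coeff_mul_halfDiff (p : ℂ[T;T⁻¹]) (n : ℤ) :
    (p * halfDiff).coeff n = (p.coeff (n - 1) - p.coeff (n + 1)) / 2 := by
  rw [halfDiff, mul_left_comm, coeff_C_mul, mul_sub, sub_eq_add_neg, coeff_add_apply, mul_comm p,
    mul_comm p, AddMonoidAlgebra.coeff_neg, Finsupp.neg_apply, coeff_T_mul, coeff_T_mul,
    sub_neg_eq_add]
  ring

theorem coeff_halfSum (n : ℤ) :
    halfSum.coeff n = ((if n = 1 then 1 else 0) + (if n = -1 then 1 else 0)) / 2 := by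
  rw [← one_mul halfSum, coeff_mul_halfSum, ← map_one C, C_apply, C_apply]
  simp only [sub_eq_zero, ← eq_neg_iff_add_eq_zero]

theorem coeff_halfDiff (n : ℤ) :
    halfDiff.coeff n = ((if n = 1 then 1 else 0) - (if n = -1 then 1 else 0)) / 2 := by
  rw [← one_mul halfDiff, coeff_mul_halfDiff, ← map_one C, C_apply, C_apply]
  simp only [sub_eq_zero, ← eq_neg_iff_add_eq_zero]

/-- The identity matrix with the block `[h, k; k, h]` in the rows and columns `p`, `q`. -/
def butterfly {s : ℕ} (p q : Fin s) (h k : ℂ[T;T⁻¹]) : LMat s s := fun i j =>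
  if j = p then (if i = p then h else if i = q then k else 0)
  else if j = q then (if i = p then k else if i = q then h else 0)
  else if i = j then 1 else 0

theorem mul_butterfly_apply {r s : ℕ} {p q : Fin s} (hpq : p ≠ q) (h k : ℂ[T;T⁻¹])
    (M : LMat r s) (i : Fin r) (j : Fin s) :
    (M * butterfly p q h k) i j =
      if j = p then M i p * h + M i q * k
      else if j = q then M i p * k + M i q * h else M i j := by
  have key : ∀ a b : ℂ[T;T⁻¹], ∑ l, M i l * (if l = p then a else if l = q then b else 0)
      = M i p * a + M i q * b := fun a b => by
    have : ∀ l, M i l * (if l = p then a else if l = q then b else 0)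
        = (if l = p then M i l * a else 0) + (if l = q then M i l * b else 0) := fun l => by
      by_cases h1 : l = p
      · simp [h1, hpq]
      · simp [h1]
    simp only [this, Finset.sum_add_distrib, Finset.sum_ite_eq', Finset.mem_univ, if_true]
  rw [Matrix.mul_apply]
  by_cases h1 : j = p
  · simp only [butterfly, h1, if_true]
    exact key h k
  · by_cases h2 : j = q
    · simp only [butterfly, h2, hpq.symm, if_true, if_false]
      exact key k h
    · simp [butterfly, h1, h2]

theorem mstar_butterfly {s : ℕ} {p q : Fin s} (hpq : p ≠ q) (h k : ℂ[T;T⁻¹]) :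
    mstar (butterfly p q h k) = butterfly p q (pstar h) (pstar k) := by
  ext1 i j
  rw [mstar, butterfly, butterfly]
  by_cases h1 : i = p <;> by_cases h2 : i = q <;> by_cases h3 : j = p <;> by_cases h4 : j = q <;>
    by_cases h5 : i = j <;> simp_all [pstar_zero, pstar_one, eq_comm]

theorem isParaunitary_butterfly {s : ℕ} {p q : Fin s} (hpq : p ≠ q) :
    IsParaunitary (butterfly p q halfSum halfDiff) := by
  have e := halfSum_sq_sub_halfDiff_sq
  rw [IsParaunitary, mstar_butterfly hpq, pstar_halfSum, pstar_halfDiff]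
  ext1 i j
  rw [mul_butterfly_apply hpq, Matrix.one_apply]
  simp only [butterfly]
  by_cases h1 : i = p <;> by_cases h2 : i = q <;> by_cases h3 : j = p <;> by_cases h4 : j = q <;>
    simp_all [eq_comm]
  all_goals first | (linear_combination e) | ring

theorem hasSym_halfSum : HasSym halfSum ⟨1, 0⟩ := by
  intro k
  simp only [coeff_halfSum, zero_sub, neg_eq_iff_eq_neg, neg_neg]
  simp [add_comm]

theorem hasSym_halfDiff : HasSym halfDiff ⟨-1, 0⟩ := by
  intro k
  simp only [coeff_halfDiff, zero_sub, neg_eq_iff_eq_neg, neg_neg]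
  simp only [Units.val_neg, Units.val_one, Int.cast_neg, Int.cast_one]
  ring

theorem halfSum_parity {n : ℤ} (h : halfSum.coeff n ≠ 0) : n = 1 ∨ n = -1 := by
  by_contra! h'
  exact h (by rw [coeff_halfSum, if_neg h'.1, if_neg h'.2]; simp)

theorem halfDiff_parity {n : ℤ} (h : halfDiff.coeff n ≠ 0) : n = 1 ∨ n = -1 := by
  by_contra! h'
  exact h (by rw [coeff_halfDiff, if_neg h'.1, if_neg h'.2]; simp)

theorem hasCoeffsIn_butterfly {K : Subfield ℂ} {s : ℕ} (p q : Fin s) :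
    HasCoeffsIn K (butterfly p q halfSum halfDiff) := by
  have h2 : (2 : ℂ) ∈ K := ofNat_mem K 2
  have hite : ∀ (c : Prop) [Decidable c], (if c then (1 : ℂ) else 0) ∈ K := fun c _ => by
    split_ifs
    exacts [K.one_mem, K.zero_mem]
  have h1 : ∀ n, halfSum.coeff n ∈ K := fun n => by
    rw [coeff_halfSum]
    exact K.div_mem (K.add_mem (hite _) (hite _)) h2
  have h3 : ∀ n, halfDiff.coeff n ∈ K := fun n => by
    rw [coeff_halfDiff]
    exact K.div_mem (K.sub_mem (hite _) (hite _)) h2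
  intro i j n
  rw [butterfly]
  split_ifs
  exacts [h1 n, h3 n, K.zero_mem, h3 n, h1 n, K.zero_mem,
    by rw [← map_one C, C_apply]; exact hite _, K.zero_mem]

/-- The pattern vector with the exponents at `p`, `q` switched between `0` and `-1`. -/
def togglePattern {s : ℕ} (p q : Fin s) (σ : Fin s → SymType) : Fin s → SymType := fun j =>
  if j = p ∨ j = q then ⟨(σ j).sign, -1 - (σ j).exp⟩ else σ j

theorem sign_togglePattern {s : ℕ} (p q : Fin s) (σ : Fin s → SymType) (j : Fin s) :
    (togglePattern p q σ j).sign = (σ j).sign := by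
  rw [togglePattern]; split_ifs <;> rfl

/-- The block contains only odd powers of w, so the parity of the exponents must flip in columns p
and q. The even entry links equal signs and the odd entry links opposite signs. -/
theorem isGraded_butterfly {s : ℕ} {p q : Fin s} {σ : Fin s → SymType} {e : ℤ}
    (hp : σ p = ⟨1, e⟩) (hq : σ q = ⟨-1, e⟩) :
    IsGraded σ (togglePattern p q σ) (butterfly p q halfSum halfDiff) := by
  have hpq : p ≠ q := by
    rintro rfl
    rw [hp] at hq
    simp at hq
  constructor
  · intro i j
    have hs : starMul (signPattern σ) (signPattern (togglePattern p q σ)) i j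
        = ⟨(σ i).sign * (σ j).sign, 0⟩ := by
      simp [starMul, signPattern, sign_togglePattern]
    rw [hs, butterfly]
    split_ifs with h1 h2 h3 h4 h5 h6 h7
    · rw [h1, h2, hp]; exact hasSym_halfSum
    · rw [h1, h3, hp, hq]; exact hasSym_halfDiff
    · exact hasSym_zero _
    · rw [h4, h5, hp, hq]; exact hasSym_halfDiff
    · rw [h4, h6, hq]; exact hasSym_halfSum
    · exact hasSym_zero _
    · rw [h7, Int.units_mul_self]
      have := hasSymMatrix_one (fun _ : Fin s => (⟨1, 0⟩ : SymType)) j j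
      rw [Matrix.one_apply_eq] at this
      exact this
    · exact hasSym_zero _
  · intro i j n h
    rw [butterfly] at h
    rw [togglePattern]
    split_ifs at h with h1 h2 h3 h4 h5 h6 h7
    · rw [if_pos (Or.inl h1), h1, h2, hp]
      rcases halfSum_parity h with h | h <;> dsimp only <;> omega
    · rw [if_pos (Or.inl h1), h1, h3, hp, hq]
      rcases halfDiff_parity h with h | h <;> dsimp only <;> omega
    · exact absurd rfl h
    · rw [if_pos (Or.inr h4), h4, h5, hp, hq]
      rcases halfDiff_parity h with h | h <;> dsimp only <;> omega
    · rw [if_pos (Or.inr h4), h4, h6, hq]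
      rcases halfSum_parity h with h | h <;> dsimp only <;> omega
    · exact absurd rfl h
    · rw [← map_one C, C_apply] at h
      simp only [ne_eq, ite_eq_right_iff, one_ne_zero, imp_false, not_not] at h
      rw [if_neg (by tauto), h7, h]
      simp
    · exact absurd rfl h

/-! ### Rank-one steps -/

/-- The `i`-th row of `M` has no terms of degree below `-d`. -/
def RowLowerBound {r s : ℕ} (M : LMat r s) (i : Fin r) (d : ℤ) : Prop :=
  ∀ j n, n < -d → (M i j).coeff n = 0

theorem RowLowerBound.mono {r s : ℕ} {M : LMat r s} {i : Fin r} {d d' : ℤ}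
    (h : RowLowerBound M i d) (hd : d ≤ d') : RowLowerBound M i d' :=
  fun j n hn => h j n (by omega)

/-- All exponents of the pattern vector lie in `{0, -1}`. -/
def IsNormalized {s : ℕ} (σ : Fin s → SymType) : Prop :=
  ∀ j, (σ j).exp = 0 ∨ (σ j).exp = -1

theorem RowLowerBound.mul_map_C {r s t : ℕ} {M : LMat r s} {i : Fin r} {d : ℤ}
    (h : RowLowerBound M i d) (V : Matrix (Fin s) (Fin t) ℂ) :
    RowLowerBound (M * V.map C) i d := by
  intro j n hn
  have := congrFun (coeff_mul_map_C M V i n) j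
  simp only [show (fun l => (M i l).coeff n) = 0 from funext fun l => h l n hn,
    zero_vecMul] at this
  exact this

/-- A is a rotation of x to ρ(e_p + e_q) followed by the butterfly. The degree can only grow through
e_p - e_q, and the two final properties control this component: it vanishes in the lowest
coefficient of any row orthogonal to x in the signed form, and for the row led by x it also vanishes
one degree higher. -/
theorem exists_rank_one_step {K : Subfield ℂ} (hK : IsAdmissibleField K) {s : ℕ}
    {σ : Fin s → SymType} (hσ : IsNormalized σ) {x : Fin s → ℂ} (hx : x ≠ 0)
    (hxK : ∀ j, x j ∈ K) {e : ℤ} (hxe : ∀ j, x j ≠ 0 → (σ j).exp = e)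
    (hiso : ∑ j, (((σ j).sign : ℤ) : ℂ) * (x j * star (x j)) = 0) :
    ∃ (A : LMat s s) (σ' : Fin s → SymType), IsNormalized σ' ∧ IsParaunitary A ∧
      HasCoeffsIn K A ∧ IsGraded σ σ' A ∧
      (∀ {r : ℕ} (M : LMat r s) (i : Fin r) (d : ℤ), RowLowerBound M i d →
        ∑ j, (((σ j).sign : ℤ) : ℂ) * ((M i j).coeff (-d) * star (x j)) = 0 →
        RowLowerBound (M * A) i d) ∧
      ∀ {r : ℕ} (M : LMat r s) (i : Fin r) (d : ℤ), RowLowerBound M i d →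
        (∀ j, (M i j).coeff (-d) = x j) →
        (∀ j, (σ j).exp = e → (M i j).coeff (-d + 1) = 0) → RowLowerBound (M * A) i (d - 1) := by
  obtain ⟨V, ρ, p, q, hV, hVK, hVσ, hp, hq, hxV, hVorth⟩ :=
    exists_unitary_isotropic hK σ hx hxK hxe hiso
  have hpq : p ≠ q := by
    rintro rfl
    rw [hp] at hq
    simp at hq
  have hcoeff : ∀ {r : ℕ} (M : LMat r s) (i : Fin r) (n : ℤ) (j : Fin s),
      ((M * V.map C) i j).coeff n = ((fun l => (M i l).coeff n) ᵥ* V) j := fun M i n j =>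
    congrFun (coeff_mul_map_C M V i n) j
  refine ⟨V.map C * butterfly p q halfSum halfDiff, togglePattern p q σ, fun j => ?_,
    (isParaunitary_map_C hV).mul (isParaunitary_butterfly hpq),
    (hasCoeffsIn_map_C hVK).mul (hasCoeffsIn_butterfly p q),
    hVσ.isGraded_map_C.mul (isGraded_butterfly hp hq), fun M i d hM ho j n hn => ?_,
    fun M i d hM hMx hM1 j n hn => ?_⟩
  · have := hσ j
    rw [togglePattern]
    split_ifs
    · simp only; omega
    · exact this
  · have hMV := hM.mul_map_C V
    -- At degree n, the coefficients of degree n + 1 enter only through the difference of columns p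
    -- and q.
    have heq : n + 1 ≤ -d →
        ((M * V.map C) i p).coeff (n + 1) = ((M * V.map C) i q).coeff (n + 1) := fun h => by
      rcases h.lt_or_eq with h | h
      · rw [hMV _ _ h, hMV _ _ h]
      · rw [h, hcoeff, hcoeff]
        exact hVorth _ ho
    rw [← Matrix.mul_assoc, mul_butterfly_apply hpq]
    split_ifs
    · rw [coeff_add_apply, coeff_mul_halfSum, coeff_mul_halfDiff, hMV p (n - 1) (by omega),
        hMV q (n - 1) (by omega), heq (by omega)]
      ring
    · rw [coeff_add_apply, coeff_mul_halfSum, coeff_mul_halfDiff, hMV p (n - 1) (by omega),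
        hMV q (n - 1) (by omega), heq (by omega)]
      ring
    · exact hMV _ _ hn
  · have hMV := hM.mul_map_C V
    have hlow : ∀ j, ((M * V.map C) i j).coeff (-d) = (ρ • (Pi.single p 1 + Pi.single q 1)
        : Fin s → ℂ) j := fun j => by
      rw [hcoeff, ← hxV, show (fun l => (M i l).coeff (-d)) = x from funext hMx]
    have hnext : ∀ j, (σ j).exp = e → ((M * V.map C) i j).coeff (-d + 1) = 0 := fun j hj => by
      rw [hcoeff, vecMul, dotProduct]
      refine Finset.sum_eq_zero fun l _ => ?_
      by_cases h : V l j = 0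
      · rw [h, mul_zero]
      · simp only [hM1 l ((congrArg SymType.exp (hVσ l j h)).trans hj), zero_mul]
    have heq : ((M * V.map C) i p).coeff (n + 1) = ((M * V.map C) i q).coeff (n + 1) := by
      rcases lt_trichotomy (n + 1) (-d) with h | h | h
      · rw [hMV _ _ h, hMV _ _ h]
      · rw [h, hlow, hlow]
        simp [hpq, hpq.symm]
      · rw [show n + 1 = -d + 1 by omega, hnext p (by rw [hp]), hnext q (by rw [hq])]
    rw [← Matrix.mul_assoc, mul_butterfly_apply hpq]
    split_ifs with h1 h2
    · rw [coeff_add_apply, coeff_mul_halfSum, coeff_mul_halfDiff, hMV p (n - 1) (by omega),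
        hMV q (n - 1) (by omega), heq]
      ring
    · rw [coeff_add_apply, coeff_mul_halfSum, coeff_mul_halfDiff, hMV p (n - 1) (by omega),
        hMV q (n - 1) (by omega), heq]
      ring
    -- Outside columns p and q the butterfly does nothing, but there the rotated leading coefficient
    -- is already zero.
    · rcases (show n ≤ -d by omega).lt_or_eq with h | h
      · exact hMV _ _ h
      · rw [h, hlow]
        simp [h1, h2]

/-- The extreme coefficient of a product `M N*`. -/
theorem coeff_mul_mstar_neg_add {r s t : ℕ} {ρ : Fin r → SymType} {σ : Fin s → SymType}
    {M : LMat t s} {N : LMat r s} (hN : IsGraded ρ σ N) {i : Fin t} {i' : Fin r} {d d' : ℤ}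
    (hM : RowLowerBound M i d) (hN' : RowLowerBound N i' d') :
    ((M * mstar N) i i').coeff (-(d + d')) = (((ρ i').sign : ℤ) : ℂ) *
      ∑ j, (((σ j).sign : ℤ) : ℂ) * ((M i j).coeff (-d) * star ((N i' j).coeff (-d'))) := by
  rw [coeff_mul_apply, Finset.mul_sum]
  refine Finset.sum_congr rfl fun j _ => ?_
  have hsign : ∀ ε : ℤˣ, star (((ε : ℤ) : ℂ)) = ((ε : ℤ) : ℂ) := fun ε => by
    rcases Int.units_eq_one_or ε with h | h <;> simp [h]
  have hk : ∀ k, (M i j).coeff k * (pstar (N i' j)).coeff (-(d + d') - k)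
      = if k = -d then (((ρ i').sign : ℤ) : ℂ) * ((((σ j).sign : ℤ) : ℂ) *
        ((M i j).coeff (-d) * star ((N i' j).coeff (-d')))) else 0 := fun k => by
    split_ifs with h
    · rw [h, coeff_pstar, show -(-(d + d') - -d) = -(-d') by ring, hN.coeff_neg i' j (-d'),
        map_mul, map_mul, starRingEnd_apply, starRingEnd_apply, starRingEnd_apply, hsign, hsign]
      ring
    · rcases lt_or_gt_of_ne h with h | h
      · rw [hM j k h, zero_mul]
      · rw [coeff_pstar, hN.coeff_neg, hN' j _ (by omega)]
        simp
  rw [mstar, coeff_mul_eq_sum, Finset.sum_congr rfl fun k _ => hk k, Finset.sum_ite_eq']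
  split_ifs with h
  · rfl
  · rw [Finsupp.notMem_support_iff.mp h]
    simp

/-- A paraunitary graded matrix of degree at most `2` lowers the degree of `Q` by `2`. -/
theorem exists_degree_reduction {K : Subfield ℂ} (hK : IsAdmissibleField K) {r s : ℕ}
    {ρ : Fin r → SymType} {σ : Fin s → SymType} (hσ : IsNormalized σ) {Q : LMat r s}
    (hQ : IsParaunitary Q) (hQK : HasCoeffsIn K Q) (hQg : IsGraded ρ σ Q) {m : ℤ} (hm : 2 ≤ m)
    (hQm : ∀ i, RowLowerBound Q i m) :
    ∃ (B : LMat s s) (σ' : Fin s → SymType), IsNormalized σ' ∧ IsParaunitary B ∧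
      HasCoeffsIn K B ∧ IsGraded σ σ' B ∧ (∀ i, RowLowerBound B i 2) ∧
      ∀ i, RowLowerBound (Q * B) i (m - 2) := by
  -- Induction on the sum of the degree bounds of the rows of QB, carrying the bound 2 on the
  -- accumulated factor B.
  suffices H : ∀ (N : ℕ) (B : LMat s s) (σ' : Fin s → SymType) (d : Fin r → ℕ), ∑ i, d i = N →
      IsNormalized σ' → IsParaunitary B → HasCoeffsIn K B → IsGraded σ σ' B →
      (∀ i, RowLowerBound B i 2) → (∀ i, RowLowerBound (Q * B) i (d i)) →
      ∃ (B : LMat s s) (σ' : Fin s → SymType), IsNormalized σ' ∧ IsParaunitary B ∧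
        HasCoeffsIn K B ∧ IsGraded σ σ' B ∧ (∀ i, RowLowerBound B i 2) ∧
        ∀ i, RowLowerBound (Q * B) i (m - 2) by
    refine H _ 1 σ (fun _ => m.toNat) rfl hσ isParaunitary_one hasCoeffsIn_one (isGraded_one σ)
      (fun i j n hn => ?_) fun i => ?_
    · rw [coeff_one_apply, if_neg]
      omega
    · rw [Matrix.mul_one, Int.toNat_of_nonneg (by omega)]
      exact hQm i
  intro N
  induction N using Nat.strong_induction_on with
  | _ N ih =>
    intro B σ' d hd hσ' hB hBK hBg hB2 hQB
    by_cases hall : ∀ i, (d i : ℤ) ≤ m - 2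
    · exact ⟨B, σ', hσ', hB, hBK, hBg, hB2, fun i => (hQB i).mono (hall i)⟩
    push Not at hall
    obtain ⟨i, hi⟩ := hall
    have hlt : ∑ l, Function.update d i (d i - 1) l < N := by
      rw [← hd]
      refine Finset.sum_lt_sum (fun l _ => ?_) ⟨i, Finset.mem_univ i, ?_⟩
      · by_cases h : l = i
        · rw [h, Function.update_self]; omega
        · rw [Function.update_of_ne h]
      · rw [Function.update_self]; omega
    have hupd : ∀ {M : LMat r s}, RowLowerBound M i (d i - 1) →
        (∀ l, RowLowerBound M l (d l)) →
        ∀ l, RowLowerBound M l (Function.update d i (d i - 1) l : ℕ) := fun h1 h2 l => by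
      by_cases h : l = i
      · rw [h, Function.update_self, Nat.cast_sub (by omega)]
        exact h1
      · rw [Function.update_of_ne h]
        exact h2 l
    set x : Fin s → ℂ := fun j => ((Q * B) i j).coeff (-(d i : ℤ)) with hx
    by_cases hx0 : x = 0
    · refine ih _ hlt B σ' _ rfl hσ' hB hBK hBg hB2 (hupd (fun j n hn => ?_) hQB)
      rcases (show n ≤ -(d i : ℤ) by omega).lt_or_eq with h | h
      · exact hQB i j n h
      · rw [h]; exact congrFun hx0 j
    have hQBg := hQg.mul hBg
    have hQBp : (Q * B) * mstar (Q * B) = 1 := hQ.mul hB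
    have hQBK := hQK.mul hBK
    have hsign : ∀ {ε : ℤˣ} {z : ℂ}, ((ε : ℤ) : ℂ) * z = 0 → z = 0 := fun {ε z} h => by
      have := congrArg (fun t => ((ε : ℤ) : ℂ) * t) h
      simpa only [← mul_assoc, sign_mul_self, one_mul, mul_zero] using this
    -- Here d_i > m - 2 ≥ 0, so the degree -(d_l + d_i) is nonzero and the corresponding coefficient
    -- of the identity vanishes, also for l = i.
    have horth : ∀ l, ∑ j, (((σ' j).sign : ℤ) : ℂ) *
        (((Q * B) l j).coeff (-(d l : ℤ)) * star (x j)) = 0 := fun l => by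
      have h := coeff_mul_mstar_neg_add hQBg (hQB l) (hQB i)
      rw [hQBp, coeff_one_apply, if_neg (by omega)] at h
      exact hsign h.symm
    obtain ⟨j₁, hj₁⟩ := Function.ne_iff.mp hx0
    have hpar : ∀ j n, ((Q * B) i j).coeff n ≠ 0 → 2 ∣ n + (σ' j).exp - (ρ i).exp :=
      fun j n => hQBg.parity i j n
    have hxe : ∀ j, x j ≠ 0 → (σ' j).exp = (σ' j₁).exp := fun j hj => by
      have h1 := hpar j _ hj
      have h2 := hpar j₁ _ hj₁
      have h3 := hσ' j
      have h4 := hσ' j₁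
      omega
    obtain ⟨A, τ, hτ, hA, hAK, hAg, hAkeep, hAlow⟩ :=
      exists_rank_one_step hK hσ' hx0 (fun j => hQBK i j _) hxe (horth i)
    refine ih _ hlt (B * A) τ _ rfl hτ (hB.mul hA) (hBK.mul hAK) (hBg.mul hAg) (fun l => ?_) ?_
    · refine hAkeep B l 2 (hB2 l) ?_
      -- B(QB)* = Q*, and Q* has no term of degree -(2 + d_i) because 2 + d_i > m. So A does not
      -- increase the degree of B beyond 2.
      have h := coeff_mul_mstar_neg_add hQBg (hB2 l) (hQB i)
      have hB' : B * mstar B = 1 := hB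
      rw [mstar_mul, ← Matrix.mul_assoc, hB', Matrix.one_mul, mstar, coeff_pstar,
        hQg.coeff_neg, hQm i l _ (by omega), mul_zero, map_zero] at h
      exact hsign h.symm
    · rw [← Matrix.mul_assoc]
      refine hupd ?_ fun l => hAkeep _ l _ (hQB l) (horth l)
      -- In the columns carrying x, row i contains only powers of the parity of d_i, so its
      -- coefficient of degree -d_i + 1 vanishes there.
      refine hAlow _ i _ (hQB i) (fun j => rfl) fun j hj => ?_
      by_contra hne
      have h1 := hpar j _ hne
      have h2 := hpar j₁ _ hj₁
      omega

/-! ### The substitution `z = w²` -/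

/-- The ring homomorphism `z ↦ w²`. -/
def doubling : ℂ[T;T⁻¹] →+* ℂ[T;T⁻¹] :=
  AddMonoidAlgebra.mapDomainRingHom ℂ (AddMonoidHom.mulLeft (2 : ℤ))

theorem coeff_doubling_two_mul (p : ℂ[T;T⁻¹]) (k : ℤ) : (doubling p).coeff (2 * k) = p.coeff k :=
  Finsupp.mapDomain_apply (fun a b (h : (2 : ℤ) * a = 2 * b) => by omega) p.coeff k

theorem coeff_doubling_of_not_dvd (p : ℂ[T;T⁻¹]) {n : ℤ} (hn : ¬ 2 ∣ n) :
    (doubling p).coeff n = 0 :=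
  Finsupp.mapDomain_of_notMem_range _ _ fun ⟨k, hk⟩ => hn ⟨k, hk.symm⟩

theorem doubling_T (n : ℤ) : doubling (T n) = T (2 * n) :=
  AddMonoidAlgebra.mapDomain_single

theorem doubling_pstar (p : ℂ[T;T⁻¹]) : doubling (pstar p) = pstar (doubling p) := by
  ext n
  by_cases h : 2 ∣ n
  · obtain ⟨k, rfl⟩ := h
    rw [coeff_pstar, coeff_doubling_two_mul, ← mul_neg, coeff_doubling_two_mul, coeff_pstar]
  · rw [coeff_pstar, coeff_doubling_of_not_dvd _ h, coeff_doubling_of_not_dvd _ (by omega),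
      map_zero]

/-- The substitution `z = w²`, followed by a shift that centres the entries with pattern
`starMul ρ σ` at `0`. -/
def halve {r s : ℕ} (ρ : Fin r → SymType) (σ : Fin s → SymType) (M : LMat r s) : LMat r s :=
  fun i j => T ((ρ i).exp - (σ j).exp) * doubling (M i j)

section Halve

variable {r s t : ℕ} {ρ : Fin r → SymType} {σ : Fin s → SymType} {τ : Fin t → SymType}

theorem coeff_halve (M : LMat r s) (i : Fin r) (j : Fin s) (k : ℤ) :
    (halve ρ σ M i j).coeff (2 * k + (ρ i).exp - (σ j).exp) = (M i j).coeff k := by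
  rw [halve, coeff_T_mul, show 2 * k + (ρ i).exp - (σ j).exp - ((ρ i).exp - (σ j).exp) = 2 * k by
    ring, coeff_doubling_two_mul]

theorem coeff_halve_of_not_dvd (M : LMat r s) {i : Fin r} {j : Fin s} {n : ℤ}
    (h : ¬ 2 ∣ n + (σ j).exp - (ρ i).exp) : (halve ρ σ M i j).coeff n = 0 := by
  rw [halve, coeff_T_mul, coeff_doubling_of_not_dvd]
  rwa [sub_sub_eq_add_sub]

theorem halve_mul (M : LMat r s) (N : LMat s t) :
    halve ρ τ (M * N) = halve ρ σ M * halve σ τ N := by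
  ext1 i j
  rw [halve, Matrix.mul_apply, Matrix.mul_apply, map_sum, Finset.mul_sum]
  refine Finset.sum_congr rfl fun l _ => ?_
  rw [halve, halve, map_mul, ← sub_add_sub_cancel _ (σ l).exp, T_add]
  ring

theorem halve_mstar (M : LMat r s) : halve σ ρ (mstar M) = mstar (halve ρ σ M) := by
  ext1 i j
  rw [halve, mstar, mstar, halve, pstar_mul, doubling_pstar, pstar_T, neg_sub]

theorem halve_one : halve ρ ρ 1 = 1 := by
  ext1 i j
  rw [halve]
  by_cases h : i = j
  · subst h; simp
  · simp [Matrix.one_apply_ne h]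

theorem halve_injective : Function.Injective (halve ρ σ) := fun M N h => by
  ext i j k
  rw [← coeff_halve (ρ := ρ) (σ := σ) M, h, coeff_halve]

theorem IsParaunitary.halve {M : LMat r s} (h : IsParaunitary M) :
    IsParaunitary (halve ρ σ M) := by
  have h' : M * SymExt.mstar M = 1 := h
  rw [IsParaunitary, ← halve_mstar, ← halve_mul, h', halve_one]

theorem isParaunitary_of_halve {M : LMat r s} (h : IsParaunitary (halve ρ σ M)) :
    IsParaunitary M := by
  have h' : SymExt.halve ρ σ M * mstar (SymExt.halve ρ σ M) = 1 := h
  rw [← halve_mstar, ← halve_mul, ← halve_one (ρ := ρ)] at h'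
  exact halve_injective h'

theorem HasCoeffsIn.halve {K : Subfield ℂ} {M : LMat r s} (h : HasCoeffsIn K M) :
    HasCoeffsIn K (halve ρ σ M) := by
  intro i j n
  by_cases hn : 2 ∣ n + (σ j).exp - (ρ i).exp
  · obtain ⟨k, hk⟩ := hn
    rw [show n = 2 * k + (ρ i).exp - (σ j).exp by omega, coeff_halve]
    exact h i j k
  · rw [coeff_halve_of_not_dvd _ hn]
    exact K.zero_mem

theorem HasSymMatrix.isGraded_halve {M : LMat r s} (h : HasSymMatrix M (starMul ρ σ)) :
    IsGraded ρ σ (halve ρ σ M) := by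
  refine ⟨fun i j n => ?_, fun i j n hn => ?_⟩
  · simp only [starMul, signPattern, sub_zero, zero_sub]
    by_cases hn : 2 ∣ n + (σ j).exp - (ρ i).exp
    · obtain ⟨k, hk⟩ := hn
      have := h i j k
      simp only [starMul] at this
      rw [show -n = 2 * ((σ j).exp - (ρ i).exp - k) + (ρ i).exp - (σ j).exp by omega, coeff_halve,
        show n = 2 * k + (ρ i).exp - (σ j).exp by omega, coeff_halve, this]
    · rw [coeff_halve_of_not_dvd _ hn, coeff_halve_of_not_dvd _ (by omega), mul_zero]
  · by_contra h'
    exact hn (coeff_halve_of_not_dvd _ h')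

/-- The parity condition says exactly that the substitution can be undone, so factors found in w
descend to z. -/
theorem IsGraded.exists_halve_eq {M : LMat r s} (h : IsGraded ρ σ M) :
    ∃ N : LMat r s, halve ρ σ N = M ∧ HasSymMatrix N (starMul ρ σ) := by
  have hinj : ∀ i j, Function.Injective fun k : ℤ => 2 * k + (ρ i).exp - (σ j).exp :=
    fun i j a b hab => by
      dsimp only at hab
      omega
  let N : LMat r s := fun i j => AddMonoidAlgebra.comapDomain _ (hinj i j) (M i j)
  have hN : ∀ i j k, (N i j).coeff k = (M i j).coeff (2 * k + (ρ i).exp - (σ j).exp) :=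
    fun i j k => rfl
  refine ⟨N, ?_, fun i j k => ?_⟩
  · ext i j n
    by_cases hn : 2 ∣ n + (σ j).exp - (ρ i).exp
    · obtain ⟨k, hk⟩ := hn
      rw [show n = 2 * k + (ρ i).exp - (σ j).exp by omega, coeff_halve, hN]
    · rw [coeff_halve_of_not_dvd _ hn]
      by_contra h'
      exact hn (h.parity i j n (Ne.symm h'))
  · rw [hN, hN]
    simp only [starMul, Units.val_mul, Int.cast_mul]
    rw [← h.coeff_neg]
    congr 1
    ring

/-- The Laurent matrix `M` has degree at most `d` in `w = z^{1/2}`, relative to the patterns `ρ`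
and `σ`. -/
def HalfDegreeLE (ρ : Fin r → SymType) (σ : Fin s → SymType) (M : LMat r s) (d : ℤ) : Prop :=
  ∀ i, RowLowerBound (halve ρ σ M) i d

/-- A lower bound suffices in the definition: the symmetry n ↦ -n supplies the upper one. -/
theorem HalfDegreeLE.bounds {M : LMat r s} {d : ℤ} (h : HalfDegreeLE ρ σ M d)
    (hM : HasSymMatrix M (starMul ρ σ)) {i : Fin r} {j : Fin s} {k : ℤ}
    (hk : (M i j).coeff k ≠ 0) :
    -d ≤ 2 * k + (ρ i).exp - (σ j).exp ∧ 2 * k + (ρ i).exp - (σ j).exp ≤ d := by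
  rw [← coeff_halve (ρ := ρ) (σ := σ)] at hk
  constructor <;> by_contra! hlt
  · exact hk (h i j _ hlt)
  · refine hk ?_
    have := hM.isGraded_halve.coeff_neg i j (-(2 * k + (ρ i).exp - (σ j).exp))
    rw [neg_neg] at this
    rw [this, h i j _ (neg_lt_neg hlt), mul_zero]

/-- The exponents differ by at most 1, so |2k| ≤ 3 and hence |k| ≤ 1. -/
theorem HalfDegreeLE.supportedInUnit {s : ℕ} {σ σ' : Fin s → SymType} {M : LMat s s}
    (h : HalfDegreeLE σ σ' M 2) (hM : HasSymMatrix M (starMul σ σ')) (hσ : IsNormalized σ)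
    (hσ' : IsNormalized σ') : SupportedInUnit M := fun i j k hk => by
  have h1 := h.bounds hM hk
  have h2 := hσ i
  have h3 := hσ' j
  omega

end Halve

/-! ### Elementary factors in the variable z. -/

theorem SupportedInUnit.mstar {s : ℕ} {M : LMat s s} (h : SupportedInUnit M) :
    SupportedInUnit (mstar M) := fun i j k hk => by
  rw [SymExt.mstar, coeff_pstar] at hk
  have := h j i (-k) fun h0 => hk (by rw [h0, map_zero])
  omega

theorem SupportedInUnit.map_C_mul {s : ℕ} {M : LMat s s} (h : SupportedInUnit M)
    (V : Matrix (Fin s) (Fin s) ℂ) : SupportedInUnit (V.map C * M) := fun i j k hk => by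
  rw [coeff_mul_apply] at hk
  obtain ⟨l, -, hl⟩ := Finset.exists_ne_zero_of_sum_ne_zero hk
  rw [map_apply, coeff_C_mul] at hl
  exact h l j k (right_ne_zero_of_mul hl)

theorem exists_elementary_reduction {K : Subfield ℂ} (hK : IsAdmissibleField K) {r s : ℕ}
    {ρ : Fin r → SymType} {σ : Fin s → SymType} (hσ : IsNormalized σ) {Q : LMat r s}
    (hQ : IsParaunitary Q) (hQK : HasCoeffsIn K Q) (hQs : HasSymMatrix Q (starMul ρ σ)) {m : ℤ}
    (hm : 2 ≤ m) (hQm : HalfDegreeLE ρ σ Q m) :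
    ∃ (B : LMat s s) (σ' : Fin s → SymType), IsNormalized σ' ∧ IsElementary B ∧
      HasCoeffsIn K B ∧ HasSymMatrix B (starMul σ σ') ∧ HalfDegreeLE ρ σ' (Q * B) (m - 2) := by
  obtain ⟨B', σ', hσ', hB', hBK', hBg', hB2', hQB'⟩ :=
    exists_degree_reduction hK hσ (hQ.halve (ρ := ρ) (σ := σ)) hQK.halve hQs.isGraded_halve hm hQm
  obtain ⟨B, rfl, hBs⟩ := hBg'.exists_halve_eq
  refine ⟨B, σ', hσ', ⟨isParaunitary_of_halve hB', ?_⟩, fun i j k => ?_, hBs, fun i => ?_⟩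
  · exact HalfDegreeLE.supportedInUnit hB2' hBs hσ hσ'
  · rw [← coeff_halve (ρ := σ) (σ := σ')]
    exact hBK' i j _
  · rw [halve_mul]
    exact hQB' i

/-! ### Chains of factors -/

theorem firstRows_mul_apply {r s t : ℕ} (hrs : r ≤ s) (M : LMat s t) (i : Fin r) (j : Fin t) :
    (firstRows r s * M) i j = M (Fin.castLE hrs i) j := by
  rw [Matrix.mul_apply, Finset.sum_eq_single (Fin.castLE hrs i)]
  · simp [firstRows]
  · intro l _ hl
    rw [firstRows, if_neg, zero_mul]
    exact fun h => hl (Fin.ext h.symm)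
  · simp

/-- The product `F_{n-1} ⋯ F_0`. -/
def revProd {s n : ℕ} (F : Fin n → LMat s s) : LMat s s := (List.ofFn fun j => F j.rev).prod

theorem revProd_cons {s n : ℕ} (B : LMat s s) (F : Fin n → LMat s s) :
    revProd (Fin.cons B F : Fin (n + 1) → LMat s s) = revProd F * B := by
  rw [revProd, List.ofFn_succ', List.concat_eq_append, List.prod_append, List.prod_singleton,
    Fin.rev_last, Fin.cons_zero]
  simp only [Fin.rev_castSucc, Fin.cons_succ]
  rfl

theorem revProd_snoc {s n : ℕ} (B : LMat s s) (F : Fin n → LMat s s) :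
    revProd (Fin.snoc F B : Fin (n + 1) → LMat s s) = B * revProd F := by
  rw [revProd, List.ofFn_succ, List.prod_cons, Fin.rev_zero, Fin.snoc_last]
  simp only [Fin.rev_succ, Fin.snoc_castSucc]
  rfl

theorem isParaunitary_revProd {s n : ℕ} {F : Fin n → LMat s s} (h : ∀ j, IsParaunitary (F j)) :
    IsParaunitary (revProd F) := by
  induction n with
  | zero => exact isParaunitary_one
  | succ n ih =>
    rw [← Fin.cons_self_tail F, revProd_cons]
    exact (ih fun j => h j.succ).mul (h 0)

/-- Paraunitary factors over `K` whose patterns link the pattern vectors `τ`. -/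
structure IsChain (K : Subfield ℂ) {s n : ℕ} (F : Fin n → LMat s s)
    (τ : Fin (n + 1) → Fin s → SymType) : Prop where
  coeffs : ∀ j, HasCoeffsIn K (F j)
  paraunitary : ∀ j, IsParaunitary (F j)
  symm : ∀ j, HasSymMatrix (F j) (starMul (τ j.succ) (τ j.castSucc))

namespace IsChain

variable {K : Subfield ℂ} {s n : ℕ} {F : Fin n → LMat s s} {τ : Fin (n + 1) → Fin s → SymType}

theorem cons (h : IsChain K F τ) {B : LMat s s} {σ : Fin s → SymType} (hBK : HasCoeffsIn K B)
    (hB : IsParaunitary B) (hBs : HasSymMatrix B (starMul (τ 0) σ)) :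
    IsChain K (Fin.cons B F : Fin (n + 1) → LMat s s)
      (Fin.cons σ τ : Fin (n + 2) → Fin s → SymType) := by
  refine ⟨Fin.cases hBK h.coeffs, Fin.cases hB h.paraunitary, Fin.cases ?_ fun j => ?_⟩
  · exact hBs
  · exact h.symm j

theorem snoc (h : IsChain K F τ) {B : LMat s s} {σ : Fin s → SymType} (hBK : HasCoeffsIn K B)
    (hB : IsParaunitary B) (hBs : HasSymMatrix B (starMul σ (τ (Fin.last n)))) :
    IsChain K (Fin.snoc F B : Fin (n + 1) → LMat s s)
      (Fin.snoc τ σ : Fin (n + 2) → Fin s → SymType) := by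
  refine ⟨Fin.lastCases ?_ fun j => ?_, Fin.lastCases ?_ fun j => ?_,
    Fin.lastCases ?_ fun j => ?_⟩
  · rwa [Fin.snoc_last]
  · rw [Fin.snoc_castSucc]; exact h.coeffs j
  · rwa [Fin.snoc_last]
  · rw [Fin.snoc_castSucc]; exact h.paraunitary j
  · rw [Fin.snoc_last, Fin.succ_last, Fin.snoc_last, Fin.snoc_castSucc]
    exact hBs
  · rw [Fin.snoc_castSucc, Fin.snoc_castSucc, Fin.succ_castSucc, Fin.snoc_castSucc]
    exact h.symm j

end IsChain

/-- A nonzero coefficient at k has 2k equal to a difference of two exponents in {0, -1}, so k = 0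
and the exponents agree. The symmetry of a nonzero constant then forces equal signs. -/
theorem eq_map_C_of_halfDegreeLE_zero {r s : ℕ} {ρ : Fin r → SymType} {σ : Fin s → SymType}
    (hρ : IsNormalized ρ) (hσ : IsNormalized σ) {M : LMat r s}
    (hM : HasSymMatrix M (starMul ρ σ)) (h : HalfDegreeLE ρ σ M 0) :
    ∃ V : Matrix (Fin r) (Fin s) ℂ, M = V.map C ∧ Respects ρ σ V := by
  have hk : ∀ i j k, (M i j).coeff k ≠ 0 → k = 0 ∧ (ρ i).exp = (σ j).exp := fun i j k hk => by
    have h1 := h.bounds hM hk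
    have h2 := hρ i
    have h3 := hσ j
    omega
  refine ⟨Matrix.of fun i j => (M i j).coeff 0, ?_, fun i j hij => ?_⟩
  · ext i j k
    rw [map_apply, of_apply, C_apply]
    split_ifs with h0
    · rw [h0]
    · by_contra h'
      exact h0 (hk i j k h').1
  · rw [of_apply] at hij
    have he := (hk i j 0 hij).2
    have hs := hM i j 0
    simp only [starMul, he, sub_self, Units.val_mul, Int.cast_mul] at hs
    have hs' : (((ρ i).sign : ℤ) : ℂ) * (((σ j).sign : ℤ) : ℂ) = 1 :=
      mul_right_cancel₀ hij (by rw [← hs, one_mul])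
    have hsign : (ρ i).sign = (σ j).sign := by
      rcases Int.units_eq_one_or (ρ i).sign with h1 | h1 <;>
        rcases Int.units_eq_one_or (σ j).sign with h2 | h2 <;> rw [h1, h2] at hs' ⊢ <;>
        norm_num at hs'
    cases hi : ρ i
    cases hj : σ j
    rw [hi, hj] at he hsign
    exact congrArg₂ SymType.mk hsign he

/-- Each reduction peels a factor off the right, Q = (QB)B*, and two degrees disappear. -/
theorem exists_elementary_chain {K : Subfield ℂ} (hK : IsAdmissibleField K) {r s : ℕ}
    (hrs : r ≤ s) {ρ : Fin r → SymType} (hρ : IsNormalized ρ) (n : ℕ) {σ : Fin s → SymType}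
    (hσ : IsNormalized σ) {Q : LMat r s} (hQ : IsParaunitary Q) (hQK : HasCoeffsIn K Q)
    (hQs : HasSymMatrix Q (starMul ρ σ)) (hQm : HalfDegreeLE ρ σ Q (2 * (n + 1))) :
    ∃ (F : Fin (n + 1) → LMat s s) (τ : Fin (n + 2) → Fin s → SymType), IsChain K F τ ∧
      (∀ j, SupportedInUnit (F j)) ∧ τ 0 = σ ∧
      (∀ i, τ (Fin.last (n + 1)) (Fin.castLE hrs i) = ρ i) ∧ Q = firstRows r s * revProd F := by
  induction n generalizing σ Q with
  | zero =>
    obtain ⟨B, σ', hσ', ⟨hB, hB1⟩, hBK, hBs, hQB⟩ :=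
      exists_elementary_reduction hK hσ hQ hQK hQs (by norm_num) hQm
    obtain ⟨V, hV, hVr⟩ := eq_map_C_of_halfDegreeLE_zero hρ hσ' (hQs.mul hBs) hQB
    have hVu : V * Vᴴ = 1 := by
      have h : Q * B * mstar (Q * B) = 1 := hQ.mul hB
      rw [hV, mstar_map_C, ← Matrix.map_mul,
        ← Matrix.map_one (C : ℂ →+* ℂ[T;T⁻¹]) (map_zero _) (map_one _)] at h
      refine Matrix.map_injective (f := (C : ℂ →+* ℂ[T;T⁻¹])) (fun a b hab => ?_) h
      have := congrArg (fun p => p.coeff 0) hab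
      simpa using this
    have hVK : ∀ i j, V i j ∈ K := fun i j => by
      have := (hQK.mul hBK) i j 0
      rwa [hV, map_apply, C_apply, if_pos rfl] at this
    obtain ⟨W, τ, hW, hWK, hWτ, hWV, hτ⟩ := exists_unitary_completion hK hrs hVu hVK hVr
    have hnil : IsChain K (Fin.elim0 : Fin 0 → LMat s s) (fun _ => τ) :=
      ⟨fun j => j.elim0, fun j => j.elim0, fun j => j.elim0⟩
    -- The constant completion W is merged with B* into one factor; constants do not enlarge the
    -- support.
    refine ⟨_, _, hnil.cons (B := W.map C * mstar B) (σ := σ)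
      ((hasCoeffsIn_map_C hWK).mul (hBK.mstar hK)) ((isParaunitary_map_C hW).mul hB.mstar)
      (hWτ.hasSymMatrix_map_C.mul hBs.mstar), Fin.cases (hB1.mstar.map_C_mul W) fun j => j.elim0, rfl, hτ, ?_⟩
    · have hfirst : firstRows r s * W.map C = Q * B := by
        ext1 i j
        rw [firstRows_mul_apply hrs, hV, map_apply, map_apply, hWV]
      have hBB : B * mstar B = 1 := hB
      rw [revProd_cons, show revProd (Fin.elim0 : Fin 0 → LMat s s) = 1 from rfl, Matrix.one_mul,
        ← Matrix.mul_assoc, hfirst, Matrix.mul_assoc, hBB, Matrix.mul_one]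
  | succ n ih =>
    obtain ⟨B, σ', hσ', ⟨hB, hB1⟩, hBK, hBs, hQB⟩ :=
      exists_elementary_reduction hK hσ hQ hQK hQs (by omega) hQm
    obtain ⟨F, τ, hF, hF1, hτ0, hτ, hprod⟩ := ih hσ' (hQ.mul hB) (hQK.mul hBK) (hQs.mul hBs)
      (by convert hQB using 1; push_cast; ring)
    refine ⟨_, _, hF.cons (B := mstar B) (σ := σ) (hBK.mstar hK) hB.mstar ?_,
      Fin.cases hB1.mstar hF1, rfl, hτ, ?_⟩
    · rw [hτ0]
      exact hBs.mstar
    · have hBB : B * mstar B = 1 := hB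
      rw [revProd_cons, ← Matrix.mul_assoc, ← hprod, Matrix.mul_assoc, hBB, Matrix.mul_one]

/-! ### Reorganizing matrices -/

theorem exp_normalize (σ : SymType) : σ.normalize.exp = 0 ∨ σ.normalize.exp = -1 := by
  have h1 := Int.le_ceil ((σ.exp : ℚ) / 2)
  have h2 := Int.ceil_lt_add_one ((σ.exp : ℚ) / 2)
  have h3 : σ.exp ≤ 2 * ⌈(σ.exp : ℚ) / 2⌉ := by
    have : (σ.exp : ℚ) ≤ 2 * ⌈(σ.exp : ℚ) / 2⌉ := by linarith
    exact_mod_cast this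
  have h4 : 2 * ⌈(σ.exp : ℚ) / 2⌉ < σ.exp + 2 := by
    have : (2 : ℚ) * ⌈(σ.exp : ℚ) / 2⌉ < σ.exp + 2 := by linarith
    exact_mod_cast this
  simp only [SymType.normalize]
  omega

theorem exists_isReorganizer {n : ℕ} (σ : Fin n → SymType) : ∃ U, IsReorganizer σ U := by
  refine ⟨_, (Tuple.sort fun k => (σ k).normalize.rank).symm, rfl, ?_⟩
  rw [Equiv.symm_symm]
  exact Tuple.monotone_sort fun k => (σ k).normalize.rank

theorem permMatrix_mul_conjTranspose {n : ℕ} (e : Equiv.Perm (Fin n)) :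
    e.permMatrix ℂ * (e.permMatrix ℂ)ᴴ = 1 := by
  rw [conjTranspose_permMatrix, ← permMatrix_mul, inv_mul_cancel, permMatrix_one]

/-- What is used of a reorganizing matrix: it is paraunitary over `K`, it normalizes the patterns,
and it is constant in the variable `w = z^{1/2}`. -/
theorem IsReorganizer.spec {K : Subfield ℂ} {n : ℕ} {σ : Fin n → SymType} {U : LMat n n}
    (h : IsReorganizer σ U) : ∃ (ρ : Fin n → SymType) (V : Matrix (Fin n) (Fin n) ℂ),
      IsNormalized ρ ∧ IsParaunitary U ∧ HasCoeffsIn K U ∧ HasSymMatrix U (starMul σ ρ) ∧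
      halve σ ρ U = V.map C := by
  obtain ⟨e, hU, -⟩ := h
  have hUi : ∀ i k, U i k = if e i = k then T (-⌈((σ i).exp : ℚ) / 2⌉) else 0 := fun i k => by
    rw [hU, diagonal_mul, Equiv.Perm.permMatrix, PEquiv.toMatrix_apply, mul_ite, mul_one,
      mul_zero]
    simp only [Equiv.toPEquiv_apply, Option.mem_some_iff]
  have hhalve : halve σ (fun k => (σ (e.symm k)).normalize) U = (e.permMatrix ℂ).map C := by
    ext1 i k
    rw [map_apply, Equiv.Perm.permMatrix, PEquiv.toMatrix_apply, halve, hUi]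
    simp only [Equiv.toPEquiv_apply, Option.mem_some_iff]
    split_ifs with h
    · subst h
      rw [doubling_T, ← T_add, Equiv.symm_apply_apply, SymType.normalize, map_one, ← T_zero]
      congr 1
      simp only
      ring
    · simp
  refine ⟨fun k => (σ (e.symm k)).normalize, e.permMatrix ℂ, fun k => exp_normalize _,
    isParaunitary_of_halve (ρ := σ) (σ := fun k => (σ (e.symm k)).normalize) ?_,
    fun i k m => ?_, fun i k m => ?_, hhalve⟩
  · rw [hhalve]
    exact isParaunitary_map_C (permMatrix_mul_conjTranspose e)
  · rw [hUi]
    split_ifs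
    · rw [T_apply]
      split_ifs
      exacts [K.one_mem, K.zero_mem]
    · exact K.zero_mem
  · rw [hUi]
    split_ifs with h
    · subst h
      simp only [starMul, SymType.normalize, Equiv.symm_apply_apply, Int.units_mul_self, T_apply,
        Units.val_one, Int.cast_one, one_mul]
      congr 1
      apply propext
      constructor <;> intro h <;> omega
    · simp

/-! ### The outer factor -/

section Extend

variable {r t : ℕ} (U : LMat r r)

theorem extendById_castAdd_castAdd (i j : Fin r) :
    extendById (r + t) U (Fin.castAdd t i) (Fin.castAdd t j) = U i j := by
  simp [extendById]

theorem extendById_castAdd_natAdd (i : Fin r) (j : Fin t) :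
    extendById (r + t) U (Fin.castAdd t i) (Fin.natAdd r j) = 0 := by
  simp [extendById, Fin.ext_iff]
  omega

theorem extendById_natAdd_castAdd (i : Fin t) (j : Fin r) :
    extendById (r + t) U (Fin.natAdd r i) (Fin.castAdd t j) = 0 := by
  simp [extendById, Fin.ext_iff]
  omega

theorem extendById_natAdd_natAdd (i j : Fin t) :
    extendById (r + t) U (Fin.natAdd r i) (Fin.natAdd r j) = (1 : LMat t t) i j := by
  simp [extendById, Matrix.one_apply]

theorem mstar_extendById : mstar (extendById (r + t) U) = extendById (r + t) (mstar U) := by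
  ext1 i j
  rw [mstar]
  refine Fin.addCases (fun i => ?_) (fun i => ?_) i <;>
    refine Fin.addCases (fun j => ?_) (fun j => ?_) j
  · simp only [extendById_castAdd_castAdd, mstar]
  · simp only [extendById_castAdd_natAdd, extendById_natAdd_castAdd, pstar_zero]
  · simp only [extendById_castAdd_natAdd, extendById_natAdd_castAdd, pstar_zero]
  · simp only [extendById_natAdd_natAdd]
    exact congrFun (congrFun mstar_one i) j

theorem extendById_mul (V : LMat r r) :
    extendById (r + t) U * extendById (r + t) V = extendById (r + t) (U * V) := by
  ext1 i j
  rw [Matrix.mul_apply, Fin.sum_univ_add]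
  refine Fin.addCases (fun i => ?_) (fun i => ?_) i <;>
    refine Fin.addCases (fun j => ?_) (fun j => ?_) j <;>
    simp only [extendById_castAdd_castAdd, extendById_castAdd_natAdd, extendById_natAdd_castAdd,
      extendById_natAdd_natAdd, zero_mul, mul_zero, Finset.sum_const_zero, add_zero, zero_add]
  · rw [Matrix.mul_apply]
  · rw [← Matrix.mul_apply, Matrix.one_mul]

theorem extendById_one : extendById (r + t) (1 : LMat r r) = 1 := by
  ext1 i j
  refine Fin.addCases (fun i => ?_) (fun i => ?_) i <;>
    refine Fin.addCases (fun j => ?_) (fun j => ?_) j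
  · rw [extendById_castAdd_castAdd]; simp [Matrix.one_apply]
  · rw [extendById_castAdd_natAdd, Matrix.one_apply_ne]
    simp [Fin.ext_iff]; omega
  · rw [extendById_natAdd_castAdd, Matrix.one_apply_ne]
    simp [Fin.ext_iff]; omega
  · rw [extendById_natAdd_natAdd]; simp [Matrix.one_apply]

end Extend

theorem IsParaunitary.extendById {r s : ℕ} (hrs : r ≤ s) {U : LMat r r} (h : IsParaunitary U) :
    IsParaunitary (extendById s U) := by
  obtain ⟨t, rfl⟩ := Nat.exists_eq_add_of_le hrs
  have h' : U * SymExt.mstar U = 1 := h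
  rw [IsParaunitary, mstar_extendById, extendById_mul, h', extendById_one]

theorem HasCoeffsIn.extendById {K : Subfield ℂ} {r : ℕ} (s : ℕ) {U : LMat r r}
    (h : HasCoeffsIn K U) : HasCoeffsIn K (extendById s U) := by
  intro i j k
  rw [SymExt.extendById]
  split_ifs
  · exact h _ _ _
  · rw [← map_one C, C_apply]
    split_ifs
    exacts [K.one_mem, K.zero_mem]
  · exact K.zero_mem

theorem hasSymMatrix_extendById {r s : ℕ} (hrs : r ≤ s) {U : LMat r r} {σ ρ : Fin r → SymType}
    (h : HasSymMatrix U (starMul σ ρ)) {τ : Fin s → SymType}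
    (hτ : ∀ i, τ (Fin.castLE hrs i) = ρ i) :
    HasSymMatrix (extendById s U)
      (starMul (fun i => if hi : (i : ℕ) < r then σ ⟨i, hi⟩ else τ i) τ) := by
  intro i j
  rw [extendById]
  split_ifs with h1 h2
  · have := h ⟨i, h1.1⟩ ⟨j, h1.2⟩
    rw [starMul, ← hτ] at this
    rw [starMul, dif_pos h1.1]
    exact this
  · subst h2
    have hi : ¬ (i : ℕ) < r := fun hi => h1 ⟨hi, hi⟩
    rw [starMul, dif_neg hi]
    have := hasSymMatrix_one τ i i
    rwa [Matrix.one_apply_eq] at this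
  · exact hasSym_zero _

theorem firstRows_mul_extendById {r s : ℕ} (hrs : r ≤ s) (U : LMat r r) :
    firstRows r s * extendById s U = U * firstRows r s := by
  ext1 i j
  rw [firstRows_mul_apply hrs, Matrix.mul_apply, extendById]
  by_cases hj : (j : ℕ) < r
  · rw [dif_pos ⟨i.2, hj⟩, Finset.sum_eq_single ⟨j, hj⟩]
    · simp [firstRows]
    · intro l _ hl
      rw [firstRows, if_neg fun h => hl (Fin.ext h), mul_zero]
    · simp
  · rw [dif_neg fun h => hj h.2, if_neg, Finset.sum_eq_zero]
    · intro l _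
      rw [firstRows, if_neg fun h : (l : ℕ) = j => hj (h ▸ l.2), mul_zero]
    · rintro rfl
      exact hj i.2

theorem isParaunitary_firstRows {r s : ℕ} (hrs : r ≤ s) : IsParaunitary (firstRows r s) := by
  ext1 i j
  rw [firstRows_mul_apply hrs, mstar, firstRows, Matrix.one_apply]
  by_cases h : i = j
  · simp [h, pstar_one]
  · rw [if_neg h, if_neg, pstar_zero]
    exact fun h' => h (Fin.ext h'.symm)

/-! ### The number of factors -/

/-- An entry with support length l is symmetric about its centre, so in w it occupies degrees from
-l to l, and l ≤ 2⌈l/2⌉. -/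
theorem halfDegreeLE_of_maxHalfLength_le {r s : ℕ} {P : LMat r s} {σ₁ : Fin r → SymType}
    {σ₂ : Fin s → SymType} (hP : HasSymMatrix P (starMul σ₁ σ₂)) {J : ℕ}
    (hJ : maxHalfLength P ≤ (J : WithBot ℕ)) : HalfDegreeLE σ₁ σ₂ P (2 * J) := by
  intro i j n hn
  by_contra hne
  have hdvd := hP.isGraded_halve.parity i j n hne
  obtain ⟨k, hk⟩ := hdvd
  rw [show n = 2 * k + (σ₁ i).exp - (σ₂ j).exp by omega, coeff_halve] at hne
  -- The mirror image of k also lies in the support, so the support length is at least the distance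
  -- between the two.
  have hk' : (P i j).coeff ((σ₂ j).exp - (σ₁ i).exp - k) ≠ 0 := fun h0 => hne <| by
    have h := hP i j k
    simp only [starMul] at h
    rw [h0] at h
    have h' := congrArg (fun x => (((((σ₁ i).sign * (σ₂ j).sign : ℤˣ) : ℤ) : ℂ)) * x) h
    simpa only [← mul_assoc, sign_mul_self, one_mul, mul_zero, eq_comm] using h'
  have hsupp : (P i j).coeff.support.Nonempty := ⟨k, Finsupp.mem_support_iff.mpr hne⟩
  have h1 := Finset.min'_le _ _ (Finsupp.mem_support_iff.mpr hne)
  have h2 := Finset.le_max' _ _ (Finsupp.mem_support_iff.mpr hk')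
  have h3 := (Finset.le_sup (f := fun mn : Fin r × Fin s =>
    (csLength (P mn.1 mn.2)).map fun l : ℕ => ⌈(l : ℚ) / 2⌉₊) (Finset.mem_univ (i, j))).trans hJ
  simp only [csLength, dif_pos hsupp] at h3
  have h4 := Nat.ceil_le.mp (WithBot.coe_le_coe.mp h3)
  have h5 : ((P i j).coeff.support.max' hsupp - (P i j).coeff.support.min' hsupp).toNat ≤ 2 * J := by
    have := (div_le_iff₀ (by norm_num : (0 : ℚ) < 2)).mp h4
    have h6 : ((((P i j).coeff.support.max' hsupp - (P i j).coeff.support.min' hsupp).toNat : ℕ) : ℚ)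
      ≤ ((2 * J : ℕ) : ℚ) := by
      rw [Nat.cast_mul, mul_comm]; exact this
    exact Nat.cast_le.mp h6
  omega

/-- The chain is built for U₁* P U₂, whose patterns have exponents in {0, -1}; the outer factors
then restore P, as [I, 0] diag(U₁, I) = U₁ [I, 0]. -/
theorem exists_cascade {K : Subfield ℂ} (hK : IsAdmissibleField K) {r s : ℕ} (hrs : r ≤ s)
    {P : LMat r s} (hPK : HasCoeffsIn K P) (hP : IsParaunitary P) {σ₁ : Fin r → SymType}
    {σ₂ : Fin s → SymType} {U₁ : LMat r r} {U₂ : LMat s s}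
    (hPs : HasSymMatrix P (starMul σ₁ σ₂)) (hU₁ : IsReorganizer σ₁ U₁)
    (hU₂ : IsReorganizer σ₂ U₂) :
    ∃ (J : ℕ) (F : Fin (J + 2) → LMat s s), IsCascade K P U₁ U₂ J F := by
  obtain ⟨ρ₁, V₁, hρ₁, hU₁p, hU₁K, hU₁s, hV₁⟩ := hU₁.spec (K := K)
  obtain ⟨ρ₂, V₂, hρ₂, hU₂p, hU₂K, hU₂s, hV₂⟩ := hU₂.spec (K := K)
  -- There will be J = n + 1 elementary factors; at least one is needed to carry the constant
  -- completion.
  obtain ⟨n, hn⟩ : ∃ n : ℕ, ((n + 1 : ℕ) : WithBot ℕ) = max 1 (maxHalfLength P) := by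
    induction maxHalfLength P using WithBot.recBotCoe with
    | bot => exact ⟨0, by simp⟩
    | coe m =>
      refine ⟨max 1 m - 1, ?_⟩
      rw [Nat.sub_add_cancel (le_max_left 1 m)]
      exact WithBot.coe_max 1 m
  have hQdeg : HalfDegreeLE ρ₁ ρ₂ (mstar U₁ * P * U₂) (2 * (n + 1)) := by
    have h := halfDegreeLE_of_maxHalfLength_le hPs (hn ▸ le_max_right 1 (maxHalfLength P))
    intro i
    -- In w the reorganizing matrices are constant, so they leave the degree of P unchanged.
    rw [halve_mul (σ := σ₂), halve_mul (σ := σ₁), hV₂, halve_mstar, hV₁, mstar_map_C]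
    refine RowLowerBound.mul_map_C (fun j m hm => ?_) V₂
    rw [coeff_mul_apply]
    refine Finset.sum_eq_zero fun l _ => ?_
    rw [map_apply, coeff_C_mul, h l j m (by push_cast; exact hm), mul_zero]
  obtain ⟨F, τ, hF, hF1, hτ0, hτ, hprod⟩ := exists_elementary_chain hK hrs hρ₁ n hρ₂
    ((hU₁p.mstar.mul hP).mul hU₂p) (((hU₁K.mstar hK).mul hPK).mul hU₂K)
    ((hU₁s.mstar.mul hPs).mul hU₂s) hQdeg
  have hchain := (hF.cons (B := mstar U₂) (σ := σ₂) (hU₂K.mstar hK) hU₂p.mstar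
    (by rw [hτ0]; exact hU₂s.mstar)).snoc (hU₁K.extendById s) (hU₁p.extendById hrs)
    (hasSymMatrix_extendById hrs hU₁s (τ := τ (Fin.last (n + 1))) hτ)
  refine ⟨n + 1, _, hchain.coeffs, isParaunitary_revProd hchain.paraunitary, ?_, fun j h1 h2 => ?_,
    ⟨_, hchain.symm, fun j => ⟨_, _, _, rfl, rfl⟩⟩, rfl, Fin.snoc_last _ _, hn.le⟩
  · have h1 : U₁ * mstar U₁ = 1 := hU₁p
    have h2 : U₂ * mstar U₂ = 1 := hU₂p
    refine Eq.trans ?_ (congrArg (firstRows r s * ·)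
      ((revProd_snoc _ _).trans (congrArg (extendById s U₁ * ·) (revProd_cons _ _)))).symm
    rw [← Matrix.mul_assoc, firstRows_mul_extendById hrs, Matrix.mul_assoc U₁, ← Matrix.mul_assoc
      (firstRows r s), ← hprod, Matrix.mul_assoc (mstar U₁ * P), h2, Matrix.mul_one,
      ← Matrix.mul_assoc, h1, Matrix.one_mul]
  · refine ⟨hchain.paraunitary j, ?_⟩
    induction j using Fin.lastCases with
    | last => simp at h2
    | cast j =>
      induction j using Fin.cases with
      | zero => simp at h1
      | succ j =>
        rw [Fin.snoc_castSucc]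
        exact hF1 j

/-! ### Symmetry of a cascade -/

/-- Equal patterns force α and σ to differ by one common monomial, read off from any column (here
column 0, whence `0 < s`). The same monomial corrects β. -/
theorem exists_shift_of_starMul_eq {r s : ℕ} (hs : 0 < s) {α σ : Fin r → SymType}
    {ω τ : Fin s → SymType} (h : starMul α ω = starMul σ τ) (β : Fin s → SymType) :
    ∃ β' : Fin s → SymType, starMul α β = starMul σ β' := by
  refine ⟨fun j => ⟨(β j).sign * ((τ ⟨0, hs⟩).sign * (ω ⟨0, hs⟩).sign),
    (β j).exp - ((ω ⟨0, hs⟩).exp - (τ ⟨0, hs⟩).exp)⟩, ?_⟩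
  ext1 i j
  have h0 := congrFun (congrFun h i) ⟨0, hs⟩
  simp only [starMul, SymType.mk.injEq] at h0 ⊢
  constructor
  · rw [mul_left_comm, ← mul_assoc (σ i).sign, ← h0.1, mul_assoc, Int.units_mul_self, mul_one,
      mul_comm]
  · omega

/-- Mutual compatibility lets each consecutive pair choose its own vectors. Since the pattern of the
shared factor is fixed, the two choices are related by a shift, and the induction keeps α tied to
the last factor's pattern in order to apply it. -/
theorem exists_hasSymMatrix_revProd {s : ℕ} (hs : 0 < s) (n : ℕ) {F : Fin (n + 1) → LMat s s}
    {S : Fin (n + 1) → Matrix (Fin s) (Fin s) SymType} (hF : ∀ j, HasSymMatrix (F j) (S j))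
    (hS : ∀ j : Fin n, MutuallyCompatible (S j.succ) (S j.castSucc))
    (h0 : ∃ σ τ, S 0 = starMul σ τ) :
    ∃ α β ω, S (Fin.last n) = starMul α ω ∧ HasSymMatrix (revProd F) (starMul α β) := by
  induction n with
  | zero =>
    obtain ⟨σ, τ, h⟩ := h0
    refine ⟨σ, τ, τ, h, ?_⟩
    have := hF 0
    rw [h] at this
    simpa [revProd] using this
  | succ n ih =>
    obtain ⟨α, β, ω, hα, hprod⟩ := ih (F := fun j => F j.castSucc) (S := fun j => S j.castSucc)
      (fun j => hF _) (fun j => hS j.castSucc) h0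
    obtain ⟨σ₁, σ, σ₂, h1, h2⟩ := hS (Fin.last n)
    obtain ⟨β', hβ'⟩ := exists_shift_of_starMul_eq hs (hα.symm.trans h2) β
    refine ⟨σ₁, β', σ, h1, ?_⟩
    rw [← Fin.snoc_init_self F, revProd_snoc]
    have hlast := hF (Fin.last (n + 1))
    rw [← Fin.succ_last, h1] at hlast
    rw [hβ'] at hprod
    exact hlast.mul hprod

theorem IsCascade.isParaunitary_and_hasCompatibleSym {K : Subfield ℂ} {r s J : ℕ} (hr : 1 ≤ r)
    (hrs : r ≤ s) {P : LMat r s} {U₁ : LMat r r} {U₂ : LMat s s} {F : Fin (J + 2) → LMat s s}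
    (h : IsCascade K P U₁ U₂ J F) : IsParaunitary P ∧ HasCompatibleSym P := by
  refine ⟨?_, ?_⟩
  · rw [h.product]
    exact (isParaunitary_firstRows hrs).mul h.paraunitary
  · obtain ⟨S, hS, hcomp⟩ := h.symm
    obtain ⟨σ₁, σ, σ₂, -, h0⟩ := hcomp 0
    obtain ⟨α, β, -, -, hprod⟩ :=
      exists_hasSymMatrix_revProd (by omega) (J + 1) hS hcomp ⟨σ, σ₂, h0⟩
    refine ⟨fun i => α (Fin.castLE hrs i), β, fun i j => ?_⟩
    rw [h.product, firstRows_mul_apply hrs]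
    exact hprod _ _

end SymExt

end
theorem mainTheorem5 (K : Subfield ℂ) (hK : SymExt.IsAdmissibleField K) (r s : ℕ)
    (hr : 1 ≤ r) (hrs : r ≤ s) (P : SymExt.LMat r s) (hP : SymExt.HasCoeffsIn K P) :
    ((SymExt.IsParaunitary P ∧ SymExt.HasCompatibleSym P) ↔
      ∃ (σ₁ : Fin r → SymExt.SymType) (σ₂ : Fin s → SymExt.SymType)
        (U₁ : SymExt.LMat r r) (U₂ : SymExt.LMat s s),
        SymExt.IsReorganizer σ₁ U₁ ∧ SymExt.IsReorganizer σ₂ U₂ ∧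
        ∃ (J : ℕ) (F : Fin (J + 2) → SymExt.LMat s s), SymExt.IsCascade K P U₁ U₂ J F) ∧
    (SymExt.IsParaunitary P →
      ∀ (σ₁ : Fin r → SymExt.SymType) (σ₂ : Fin s → SymExt.SymType)
        (U₁ : SymExt.LMat r r) (U₂ : SymExt.LMat s s),
        SymExt.HasSymMatrix P (SymExt.starMul σ₁ σ₂) →
        SymExt.IsReorganizer σ₁ U₁ → SymExt.IsReorganizer σ₂ U₂ →
        ∃ (J : ℕ) (F : Fin (J + 2) → SymExt.LMat s s), SymExt.IsCascade K P U₁ U₂ J F) := by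
  refine ⟨⟨fun ⟨hPp, σ₁, σ₂, hPs⟩ => ?_, fun ⟨_, _, _, _, _, _, _, _, h⟩ =>
    h.isParaunitary_and_hasCompatibleSym hr hrs⟩, fun hPp _ _ _ _ hPs hU₁ hU₂ =>
      SymExt.exists_cascade hK hrs hP hPp hPs hU₁ hU₂⟩
  obtain ⟨U₁, hU₁⟩ := SymExt.exists_isReorganizer σ₁
  obtain ⟨U₂, hU₂⟩ := SymExt.exists_isReorganizer σ₂
  exact ⟨σ₁, σ₂, U₁, U₂, hU₁, hU₂, SymExt.exists_cascade hK hrs hP hPp hPs hU₁ hU₂⟩
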